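/- All Hilbert spaces are complex and separable. Let $n\ge 1$, let $E$ be a Hilbert space, and let $H^2_E(\mathbb D^n)$ be the Hilbert space of all analytic functions $f:\mathbb D^n\to E$ with $$\|f\|=\Big(\sup_{0\le r<1}\int_{\mathbb T^n}\|f(rz_1,\dots,rz_n)\|_E^2\,dm(z)\Big)^{1/2}<\infty ,$$ where $m$ is the normalized Lebesgue measure on the torus $\mathbb T^n$. For $i=1,\dots,n$ let $M_{z_i}$ be the operator of multiplication by the coordinate function $z_i$ on $H^2_E(\mathbb D^n)$. For a Hilbert space $E_*$, a bounded analytic function $\Theta:\mathbb D^n\to\mathcal B(E_*,E)$ is called inner if $f\mapsto\Theta f$ is an isometry from $H^2_{E_*}(\mathbb D^n)$ into $H^2_E(\mathbb D^n)$. Let $Q\subseteq H^2_E(\mathbb D^n)$ be a quotient module, that is, a closed subspace with $M_{z_i}^*Q\subseteq Q$ for all $i=1,\dots,n$. Let $P_Q$ be the orthogonal projection of $H^2_E(\mathbb D^n)$ onto $Q$, and set $C_{z_i}=P_QM_{z_i}|_Q$, an operator on $Q$. Then the following are equivalent: 1. $Q$ is a Beurling quotient module, that is, there are a Hilbert space $E_*$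 and an inner function $\Theta:\mathbb D^n\to\mathcal B(E_*,E)$ such that $Q=H^2_E(\mathbb D^n)\ominus\Theta H^2_{E_*}(\mathbb D^n)$. 2. $(I_Q-C_{z_i}^*C_{z_i})(I_Q-C_{z_j}^*C_{z_j})=0$ for all $i,j\in\{1,\dots,n\}$ with $i\ne j$. -/

import Mathlib

open MeasureTheory Filter Topology
open scoped ComplexConjugate

universe u

noncomputable section

namespace Polydisc

/-- The open unit polydisc `𝔻ⁿ`. -/
def polydisc (n : ℕ) : Set (Fin n → ℂ) := {z | ∀ i, ‖z i‖ < 1}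

/-- The normalized Lebesgue measure on the `n`-torus. -/
def torusMeasure (n : ℕ) : Measure (Fin n → UnitAddCircle) :=
  Measure.pi fun _ => AddCircle.haarAddCircle

instance (n : ℕ) : IsProbabilityMeasure (torusMeasure n) := by
  unfold torusMeasure; infer_instance

/-- The point of `r 𝕋ⁿ` with angular coordinates `t`, measured in full turns:
`(r e^{2πi t₁}, …, r e^{2πi tₙ})`. -/
def torusPoint {n : ℕ} (r : ℝ) (t : Fin n → UnitAddCircle) : Fin n → ℂ :=
  fun j => (r : ℂ) * (AddCircle.toCircle (t j) : ℂ)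

/-- The integral mean `∫_{𝕋ⁿ} ‖f(r z₁, …, r zₙ)‖² dm(z)`. -/
def hardyMean {n : ℕ} {E : Type*} [NormedAddCommGroup E] (f : (Fin n → ℂ) → E) (r : ℝ) : ℝ :=
  ∫ t, ‖f (torusPoint r t)‖ ^ 2 ∂(torusMeasure n)

/-- The monomial `z^k`. -/
def mon {n : ℕ} (k : Fin n → ℕ) (z : Fin n → ℂ) : ℂ := ∏ i, z i ^ k i

lemma isOpen_polydisc (n : ℕ) : IsOpen (polydisc n) := by
  simp only [polydisc, Set.ofPred_forall]
  exact isOpen_iInter_of_finite fun i => isOpen_lt (by fun_prop) continuous_const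

lemma continuous_torusPoint {n : ℕ} (r : ℝ) :
    Continuous (torusPoint r : (Fin n → UnitAddCircle) → Fin n → ℂ) := by
  refine continuous_pi fun j => continuous_const.mul ?_
  exact continuous_subtype_val.comp (AddCircle.continuous_toCircle.comp (continuous_apply j))

lemma norm_torusPoint {n : ℕ} {r : ℝ} (hr : 0 ≤ r) (t : Fin n → UnitAddCircle) (j : Fin n) :
    ‖torusPoint r t j‖ = r := by
  simp only [torusPoint, norm_mul, Complex.norm_real, Real.norm_eq_abs, abs_of_nonneg hr, Circle.norm_coe, mul_one]

lemma torusPoint_mem {n : ℕ} {r : ℝ} (hr : 0 ≤ r) (hr1 : r < 1) (t : Fin n → UnitAddCircle) :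
    torusPoint r t ∈ polydisc n := fun j => by rw [norm_torusPoint hr]; exact hr1

lemma mon_torusPoint {n : ℕ} (k : Fin n → ℕ) (r : ℝ) (t : Fin n → UnitAddCircle) :
    mon k (torusPoint r t) = (r : ℂ) ^ (∑ i, k i) * mon k (torusPoint 1 t) := by
  simp [mon, torusPoint, mul_pow, Finset.prod_mul_distrib, Finset.prod_pow_eq_pow_sum]

lemma norm_mon_torus_one {n : ℕ} (k : Fin n → ℕ) (t : Fin n → UnitAddCircle) :
    ‖mon k (torusPoint 1 t)‖ = 1 := by
  simp [mon, norm_torusPoint zero_le_one]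

lemma continuous_mon {n : ℕ} (k : Fin n → ℕ) : Continuous (mon k) := by
  unfold mon; fun_prop

lemma norm_mon_le {n : ℕ} (k : Fin n → ℕ) (z : Fin n → ℂ) {r : ℝ} (h : ∀ i, ‖z i‖ ≤ r) :
    ‖mon k z‖ ≤ r ^ (∑ i, k i) := by
  simp only [mon, norm_prod, norm_pow]
  rw [← Finset.prod_pow_eq_pow_sum]
  exact Finset.prod_le_prod (fun i _ => by positivity)
    fun i _ => pow_le_pow_left₀ (norm_nonneg _) (h i) _

lemma integral_fourier (m : ℤ) :
    ∫ t : UnitAddCircle, fourier m t ∂AddCircle.haarAddCircle = if m = 0 then 1 else 0 := by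
  have h := orthonormal_iff_ite.mp (orthonormal_fourier (T := (1 : ℝ))) 0 m
  rw [ContinuousMap.inner_toLp] at h
  simp only [fourier_zero, map_one, mul_one] at h
  rw [h]; simp only [eq_comm]

lemma integral_mon {n : ℕ} (k l : Fin n → ℕ) :
    ∫ t, conj (mon k (torusPoint 1 t)) * mon l (torusPoint 1 t) ∂(torusMeasure n) =
      if k = l then 1 else 0 := by
  have h1 : ∀ t : Fin n → UnitAddCircle,
      conj (mon k (torusPoint 1 t)) * mon l (torusPoint 1 t) =
        ∏ i, fourier ((l i : ℤ) - k i) (t i) := by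
    intro t
    have key : ∀ (m : Fin n → ℕ), mon m (torusPoint 1 t) = ∏ i, fourier (m i : ℤ) (t i) := by
      intro m
      refine Finset.prod_congr rfl fun i _ => ?_
      simp [torusPoint, fourier_apply, AddCircle.toCircle_nsmul]
    rw [key, key, map_prod, ← Finset.prod_mul_distrib]
    refine Finset.prod_congr rfl fun i _ => ?_
    rw [sub_eq_neg_add, fourier_add, fourier_neg]
  simp_rw [h1, torusMeasure]
  rw [integral_fintype_prod_eq_prod (fun i t => fourier ((l i : ℤ) - k i) t)]
  simp_rw [integral_fourier]
  split_ifs with h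
  · subst h; simp
  · obtain ⟨i, hi⟩ := Function.ne_iff.mp h
    exact Finset.prod_eq_zero (Finset.mem_univ i) (if_neg (by omega))

section Parseval
variable {n : ℕ} {E : Type*} [NormedAddCommGroup E] [InnerProductSpace ℂ E] [CompleteSpace E]

lemma integral_series_inner {a : (Fin n → ℕ) → E} (ha : Summable fun k => ‖a k‖) (y : E)
    (l : Fin n → ℕ) :
    ∫ t, inner ℂ (mon l (torusPoint 1 t) • y) (∑' k, mon k (torusPoint 1 t) • a k)
      ∂(torusMeasure n) = inner ℂ y (a l) := by
  have hs : ∀ t, HasSum (fun k => inner ℂ (mon l (torusPoint 1 t) • y)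
      (mon k (torusPoint 1 t) • a k))
      (inner ℂ (mon l (torusPoint 1 t) • y) (∑' k, mon k (torusPoint 1 t) • a k)) := by
    intro t
    have : Summable fun k => mon k (torusPoint 1 t) • a k :=
      .of_norm (by simpa [norm_smul, norm_mon_torus_one] using ha)
    exact this.hasSum.mapL (innerSL ℂ (mon l (torusPoint 1 t) • y))
  have hI := hasSum_integral_of_summable_integral_norm (μ := torusMeasure n)
    (F := fun k t => inner ℂ (mon l (torusPoint 1 t) • y) (mon k (torusPoint 1 t) • a k)) ?_ ?_
  · simp_rw [(hs _).tsum_eq] at hI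
    rw [← hI.tsum_eq, tsum_eq_single l]
    · simp_rw [inner_smul_left, inner_smul_right, ← mul_assoc]
      rw [integral_mul_const, integral_mon]; simp
    · intro k hk
      simp_rw [inner_smul_left, inner_smul_right, ← mul_assoc]
      rw [integral_mul_const, integral_mon, if_neg (Ne.symm hk)]; simp
  · intro k
    refine Continuous.integrable_of_hasCompactSupport ?_ (HasCompactSupport.of_compactSpace _)
    exact Continuous.inner
      (((continuous_mon l).comp (continuous_torusPoint 1)).smul continuous_const)
      (((continuous_mon k).comp (continuous_torusPoint 1)).smul continuous_const)
  · refine .of_nonneg_of_le (fun k => by positivity) (fun k => ?_) (ha.mul_left ‖y‖)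
    have : ∀ t, ‖inner ℂ (mon l (torusPoint 1 t) • y) (mon k (torusPoint 1 t) • a k)‖
        ≤ ‖y‖ * ‖a k‖ := fun t => by
      refine (norm_inner_le_norm _ _).trans ?_
      simp [norm_smul, norm_mon_torus_one]
    calc _ ≤ ∫ t, ‖y‖ * ‖a k‖ ∂(torusMeasure n) :=
          integral_mono_of_nonneg (.of_forall fun t => norm_nonneg _) (integrable_const _)
            (.of_forall this)
      _ = _ := by simp

lemma continuous_series {a : (Fin n → ℕ) → E} (ha : Summable fun k => ‖a k‖) :
    Continuous fun t => ∑' k, mon k (torusPoint 1 t) • a k := by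
  refine continuous_tsum (fun k => ?_) ha fun k t => ?_
  · exact ((continuous_mon k).comp (continuous_torusPoint 1)).smul continuous_const
  · simp [norm_smul, norm_mon_torus_one]

lemma hasSum_parseval {a : (Fin n → ℕ) → E} (ha : Summable fun k => ‖a k‖) :
    HasSum (fun k => ‖a k‖ ^ 2)
      (∫ t, ‖∑' k, mon k (torusPoint 1 t) • a k‖ ^ 2 ∂(torusMeasure n)) := by
  set S : (Fin n → UnitAddCircle) → E := fun t => ∑' k, mon k (torusPoint 1 t) • a k with hS
  have hSc : Continuous S := continuous_series ha
  have hSn : ∀ t, ‖S t‖ ≤ ∑' k, ‖a k‖ := fun t => by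
    refine (norm_tsum_le_tsum_norm ?_).trans (le_of_eq ?_)
    · simpa [norm_smul, norm_mon_torus_one] using ha
    · simp [norm_smul, norm_mon_torus_one]
  have hs : ∀ t, HasSum (fun k => inner ℂ (mon k (torusPoint 1 t) • a k) (S t))
      (inner ℂ (S t) (S t)) := by
    intro t
    have : Summable fun k => mon k (torusPoint 1 t) • a k :=
      .of_norm (by simpa [norm_smul, norm_mon_torus_one] using ha)
    have h2 := (this.hasSum.mapL (innerSL ℂ (S t))).map (starRingEnd ℂ) Complex.continuous_conj
    simpa only [Function.comp_def, innerSL_apply_apply, inner_conj_symm] using h2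
  have hI := hasSum_integral_of_summable_integral_norm (μ := torusMeasure n)
    (F := fun k t => inner ℂ (mon k (torusPoint 1 t) • a k) (S t)) ?_ ?_
  · simp_rw [(hs _).tsum_eq, hS, integral_series_inner ha, inner_self_eq_norm_sq_to_K] at hI
    have h3 := Complex.hasSum_re hI
    have h4 : ∫ t, ((‖S t‖ : ℂ)) ^ 2 ∂(torusMeasure n)
        = ((∫ t, ‖S t‖ ^ 2 ∂(torusMeasure n) : ℝ) : ℂ) := by
      rw [← integral_complex_ofReal]; simp
    simp only [Complex.coe_algebraMap] at h3
    rw [h4, Complex.ofReal_re] at h3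
    refine h3.congr_fun ?_
    intro k; norm_cast
  · intro k
    refine Continuous.integrable_of_hasCompactSupport ?_ (HasCompactSupport.of_compactSpace _)
    exact Continuous.inner
      (((continuous_mon k).comp (continuous_torusPoint 1)).smul continuous_const) hSc
  · refine .of_nonneg_of_le (fun k => by positivity) (fun k => ?_)
      (ha.mul_right (∑' k, ‖a k‖))
    have : ∀ t, ‖inner ℂ (mon k (torusPoint 1 t) • a k) (S t)‖
        ≤ ‖a k‖ * ∑' k, ‖a k‖ := fun t => by
      refine (norm_inner_le_norm _ _).trans ?_
      rw [norm_smul, norm_mon_torus_one, one_mul]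
      exact mul_le_mul_of_nonneg_left (hSn t) (norm_nonneg _)
    calc _ ≤ ∫ t, ‖a k‖ * ∑' k, ‖a k‖ ∂(torusMeasure n) :=
          integral_mono_of_nonneg (.of_forall fun t => norm_nonneg _) (integrable_const _)
            (.of_forall this)
      _ = _ := by simp

lemma hasSum_hardyMean {f : (Fin n → ℂ) → E} {a : (Fin n → ℕ) → E} {r : ℝ} (hr : 0 ≤ r)
    (hr1 : r < 1) (hs : Summable fun k => ‖a k‖ * r ^ (∑ i, k i))
    (hf : ∀ z ∈ polydisc n, f z = ∑' k, mon k z • a k) :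
    HasSum (fun k => ‖a k‖ ^ 2 * (r ^ (∑ i, k i)) ^ 2) (hardyMean f r) := by
  have h := hasSum_parseval (a := fun k => ((r : ℂ) ^ (∑ i, k i)) • a k)
    (hs.congr fun k => by
      rw [norm_smul, norm_pow, Complex.norm_real, Real.norm_of_nonneg hr, mul_comm])
  have e : ∀ t, ∑' k, mon k (torusPoint 1 t) • ((r : ℂ) ^ (∑ i, k i)) • a k
      = f (torusPoint r t) := fun t => by
    rw [hf _ (torusPoint_mem hr hr1 t)]
    refine tsum_congr fun k => ?_
    rw [mon_torusPoint k r, smul_smul, mul_comm]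
  simp_rw [e] at h
  refine h.congr_fun fun k => ?_
  rw [norm_smul, norm_pow, Complex.norm_real, Real.norm_of_nonneg hr]
  ring

end Parseval

section Taylor

lemma summable_pow_sum {q : ℝ} (hq : 0 ≤ q) (hq1 : q < 1) (n : ℕ) :
    Summable fun k : Fin n → ℕ => q ^ (∑ i, k i) := by
  induction n with
  | zero => exact (hasSum_fintype _).summable
  | succ n ih =>
    rw [← (Fin.consEquiv fun _ : Fin (n + 1) => ℕ).summable_iff]
    refine ((summable_geometric_of_lt_one hq hq1).mul_of_nonneg ih (fun _ => by positivity)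
      fun _ => by positivity).congr fun p => ?_
    simp [Fin.consEquiv, Fin.sum_univ_succ, pow_add]

variable {E : Type*} [NormedAddCommGroup E]

lemma summable_of_bound {n : ℕ} {a : (Fin n → ℕ) → E} {r s M : ℝ} (hr : 0 ≤ r) (hrs : r < s)
    (h : ∀ k, ‖a k‖ * s ^ (∑ i, k i) ≤ M) : Summable fun k => ‖a k‖ * r ^ (∑ i, k i) := by
  have hs : 0 < s := hr.trans_lt hrs
  refine .of_nonneg_of_le (fun k => by positivity) (fun k => ?_)
    ((summable_pow_sum (q := r / s) (by positivity) ((div_lt_one hs).2 hrs) n).mul_left M)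
  calc ‖a k‖ * r ^ (∑ i, k i) = (‖a k‖ * s ^ (∑ i, k i)) * (r / s) ^ (∑ i, k i) := by
        rw [div_pow, mul_assoc, mul_div_cancel₀ _ (by positivity)]
    _ ≤ _ := mul_le_mul_of_nonneg_right (h k) (by positivity)

lemma exists_radius {n : ℕ} {z : Fin n → ℂ} (hz : z ∈ polydisc n) :
    ∃ r : ℝ, 0 ≤ r ∧ r < 1 ∧ ∀ i, ‖z i‖ ≤ r :=
  ⟨‖z‖, norm_nonneg _, (pi_norm_lt_iff one_pos).2 hz, norm_le_pi_norm z⟩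

variable [NormedSpace ℂ E]

lemma exists_bound {n : ℕ} {f : (Fin n → ℂ) → E} (hf : AnalyticOnNhd ℂ f (polydisc n)) {s : ℝ}
    (hs : s < 1) : ∃ M, ∀ z, (∀ i, ‖z i‖ ≤ s) → ‖f z‖ ≤ M := by
  have hK : IsCompact {z : Fin n → ℂ | ∀ i, ‖z i‖ ≤ s} := by
    convert isCompact_univ_pi (X := fun _ : Fin n => ℂ)
      fun _ => ProperSpace.isCompact_closedBall (0 : ℂ) s using 1
    ext z; simp
  obtain ⟨M, hM⟩ := hK.exists_bound_of_continuousOn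
    (hf.continuousOn.mono fun z hz i => (hz i).trans_lt hs)
  exact ⟨M, fun z hz => hM z hz⟩

lemma cons_mem_polydisc {n : ℕ} {w : ℂ} {z : Fin n → ℂ} :
    (Fin.cons w z : Fin (n + 1) → ℂ) ∈ polydisc (n + 1) ↔ ‖w‖ < 1 ∧ z ∈ polydisc n := by
  simp [polydisc, Fin.forall_fin_succ]

lemma exists_slices [CompleteSpace E] {n : ℕ} {f : (Fin (n + 1) → ℂ) → E}
    (hf : AnalyticOnNhd ℂ f (polydisc (n + 1))) :
    ∃ g : ℕ → (Fin (n + 1) → ℂ) → E, (∀ m, AnalyticOnNhd ℂ (g m) (polydisc (n + 1))) ∧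
      ∀ m, ∀ w : ℂ, ‖w‖ < 1 → ∀ z ∈ polydisc n,
        iteratedDeriv m (fun w => f (Fin.cons w z)) w = g m (Fin.cons w z) := by
  have han : ∀ m, AnalyticOnNhd ℂ ((fun h z => fderiv ℂ h z (Pi.single 0 1))^[m] f)
      (polydisc (n + 1)) := by
    intro m
    induction m with
    | zero => exact hf
    | succ m ih =>
      rw [Function.iterate_succ_apply']
      intro z hz
      exact ((ContinuousLinearMap.apply ℂ E (Pi.single 0 1 : Fin (n + 1) → ℂ)).analyticAt _).comp
        (ih.fderiv z hz)
  refine ⟨fun m => (fun h z => fderiv ℂ h z (Pi.single 0 1))^[m] f, han, fun m => ?_⟩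
  · beta_reduce
    induction m with
    | zero => intro w _ z _; simp
    | succ m ih =>
      intro w hw z hz
      rw [iteratedDeriv_succ, Function.iterate_succ_apply']
      have hev : iteratedDeriv m (fun w => f (Fin.cons w z)) =ᶠ[𝓝 w]
          fun w => ((fun h z => fderiv ℂ h z (Pi.single 0 1))^[m] f) (Fin.cons w z) := by
        filter_upwards [(isOpen_lt continuous_norm continuous_const).mem_nhds hw] with v hv
        exact ih v hv z hz
      rw [hev.deriv_eq]
      have hd := (han m _ (cons_mem_polydisc.2 ⟨hw, hz⟩)).differentiableAt.hasFDerivAt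
      have hc : HasDerivAt (fun w : ℂ => (Fin.cons w z : Fin (n + 1) → ℂ)) (Pi.single 0 1) w := by
        rw [hasDerivAt_pi]
        intro i
        refine Fin.cases ?_ (fun j => ?_) i
        · simp only [Fin.cons_zero, Pi.single_eq_same]; exact hasDerivAt_id w
        · simpa using hasDerivAt_const w (z j)
      exact (hd.comp_hasDerivAt w hc).deriv

/-- Multivariable Taylor expansion on the polydisc, with Cauchy estimates. -/
lemma exists_taylor [CompleteSpace E] (n : ℕ) : ∀ f : (Fin n → ℂ) → E, AnalyticOnNhd ℂ f (polydisc n) →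
    ∃ a : (Fin n → ℕ) → E,
      (∀ s : ℝ, 0 < s → s < 1 → ∀ M, (∀ z, (∀ i, ‖z i‖ ≤ s) → ‖f z‖ ≤ M) →
        ∀ k, ‖a k‖ * s ^ (∑ i, k i) ≤ M) ∧
      ∀ z ∈ polydisc n, HasSum (fun k => mon k z • a k) (f z) := by
  induction n with
  | zero =>
    intro f _
    refine ⟨fun _ => f 0, fun s _ _ M h k => by simpa using h 0 (by simp), fun z _ => ?_⟩
    have h0 : z = 0 := Subsingleton.elim _ _
    subst h0
    convert hasSum_unique (f := fun k : Fin 0 → ℕ => mon k (0 : Fin 0 → ℂ) • f 0) using 1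
    simp [mon]
  | succ n ih =>
    intro f hf
    obtain ⟨g, hg, hgd⟩ := exists_slices hf
    have hG : ∀ m, AnalyticOnNhd ℂ (fun z : Fin n → ℂ => (m.factorial : ℂ)⁻¹ • g m (Fin.cons 0 z))
        (polydisc n) := by
      intro m z hz
      have h1 : AnalyticAt ℂ (fun z : Fin n → ℂ => (Fin.cons 0 z : Fin (n + 1) → ℂ)) z := by
        refine AnalyticAt.pi fun i => ?_
        refine Fin.cases ?_ (fun j => ?_) i
        · simp only [Fin.cons_zero]; exact analyticAt_const
        · simp only [Fin.cons_succ]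
          exact (ContinuousLinearMap.proj (R := ℂ) (φ := fun _ : Fin n => ℂ) j).analyticAt z
      have h2 : AnalyticAt ℂ (g m) (Fin.cons 0 z : Fin (n + 1) → ℂ) :=
        hg m _ (cons_mem_polydisc.2 ⟨by simp, hz⟩)
      exact analyticAt_const.smul (h2.comp_of_eq h1 rfl)
    choose b hb1 hb2 using fun m => ih _ (hG m)
    have hdiff : ∀ z ∈ polydisc n, DifferentiableOn ℂ (fun w : ℂ => f (Fin.cons w z))
        (Metric.ball 0 1) := by
      intro z hz w hw
      have hw' : ‖w‖ < 1 := by simpa using hw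
      have h1 := (hf _ (cons_mem_polydisc.2 ⟨hw', hz⟩)).differentiableAt
      have h2 : DifferentiableAt ℂ (fun w : ℂ => (Fin.cons w z : Fin (n + 1) → ℂ)) w := by
        rw [differentiableAt_pi]
        intro i
        refine Fin.cases ?_ (fun j => ?_) i
        · simp
        · simp
      exact (h1.comp w h2).differentiableWithinAt
    have hbd : ∀ s : ℝ, 0 < s → s < 1 → ∀ M, (∀ z, (∀ i, ‖z i‖ ≤ s) → ‖f z‖ ≤ M) →
        ∀ k : Fin (n + 1) → ℕ, ‖b (k 0) (Fin.tail k)‖ * s ^ (∑ i, k i) ≤ M := by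
      intro s hs hs1 M hM k
      have hC := hb1 (k 0) s hs hs1 (M / s ^ (k 0)) (fun z hz => ?_) (Fin.tail k)
      · rw [Fin.sum_univ_succ, pow_add]
        rw [le_div_iff₀ (by positivity)] at hC
        calc _ = ‖b (k 0) (Fin.tail k)‖ * s ^ (∑ i, Fin.tail k i) * s ^ k 0 := by
              simp only [Fin.tail]; ring
          _ ≤ M := hC
      · have hzp : z ∈ polydisc n := fun i => (hz i).trans_lt hs1
        rw [← hgd (k 0) 0 (by simp) z hzp, norm_smul]
        have hcau := Complex.norm_iteratedDeriv_le_of_forall_mem_sphere_norm_le (k 0) hs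
          (f := fun w => f (Fin.cons w z)) (c := 0) (C := M)
          (((hdiff z hzp).mono (by
            rw [closure_ball _ hs.ne']
            exact Metric.closedBall_subset_ball hs1)).diffContOnCl) (fun w hw => hM _ fun i => by
              refine Fin.cases ?_ (fun j => ?_) i
              · simpa using (mem_sphere_zero_iff_norm.1 hw).le
              · simpa using hz j)
        have hf0 : (0 : ℝ) < (k 0).factorial := by positivity
        rw [norm_inv, RCLike.norm_natCast, inv_mul_le_iff₀ hf0, ← mul_div_assoc]
        exact hcau
    refine ⟨fun k => b (k 0) (Fin.tail k), hbd, fun z hz => ?_⟩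
    obtain ⟨w, z, rfl⟩ : ∃ w z', z = (Fin.cons w z' : Fin (n + 1) → ℂ) :=
      ⟨z 0, Fin.tail z, (Fin.cons_self_tail z).symm⟩
    obtain ⟨r, hr0, hr1, hr⟩ := exists_radius hz
    obtain ⟨s, hrs, hs1⟩ := exists_between hr1
    obtain ⟨M, hM⟩ := exists_bound hf hs1
    have hsum : Summable fun k : Fin (n + 1) → ℕ =>
        mon k (Fin.cons w z : Fin (n + 1) → ℂ) • b (k 0) (Fin.tail k) := by
      refine .of_norm_bounded
        (summable_of_bound hr0 hrs (hbd s (hr0.trans_lt hrs) hs1 M hM)) fun k => ?_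
      rw [norm_smul, mul_comm]
      exact mul_le_mul_of_nonneg_left (norm_mon_le k _ hr) (norm_nonneg _)
    obtain ⟨hw, hzp⟩ := cons_mem_polydisc.1 hz
    rw [← (Fin.consEquiv fun _ : Fin (n + 1) => ℕ).hasSum_iff]
    rw [← (Fin.consEquiv fun _ : Fin (n + 1) => ℕ).summable_iff] at hsum
    have hinner : ∀ m, HasSum (fun k : Fin n → ℕ =>
        ((fun k : Fin (n + 1) → ℕ => mon k (Fin.cons w z : Fin (n + 1) → ℂ) •
          b (k 0) (Fin.tail k)) ∘ (Fin.consEquiv fun _ : Fin (n + 1) => ℕ)) (m, k))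
        (w ^ m • (m.factorial : ℂ)⁻¹ • g m (Fin.cons 0 z)) := by
      intro m
      refine ((hb2 m z hzp).const_smul (w ^ m)).congr_fun fun k => ?_
      simp [mon, Fin.consEquiv, Fin.prod_univ_succ, smul_smul]
    have h1 := hsum.hasSum.prod_fiberwise hinner
    have h2 := Complex.hasSum_taylorSeries_on_ball (z := w) (c := 0) (hdiff z hzp) (by simpa using hw)
    have h3 : HasSum (fun m : ℕ => w ^ m • (m.factorial : ℂ)⁻¹ • g m (Fin.cons 0 z))
        (f (Fin.cons w z)) := by
      refine h2.congr_fun fun m => ?_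
      rw [hgd m 0 (by simp) z hzp, sub_zero, smul_comm]
    have := hsum.hasSum
    rwa [h1.unique h3] at this

/-- The bounded family `k ↦ (w / s) ^ kᵢ`, written as a power series in `w`. -/
def powFamily {n : ℕ} (s : ℝ) (i : Fin n) (w : ℂ) :
    BoundedContinuousFunction (Fin n → ℕ) ℂ :=
  ∑' m : ℕ, (w / s) ^ m • BoundedContinuousFunction.ofNormedAddCommGroupDiscrete
    (fun k : Fin n → ℕ => if k i = m then (1 : ℂ) else 0) 1
    (fun k => by split_ifs <;> simp)

lemma norm_indicator_le {n : ℕ} (i : Fin n) (m : ℕ) :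
    ‖BoundedContinuousFunction.ofNormedAddCommGroupDiscrete
    (fun k : Fin n → ℕ => if k i = m then (1 : ℂ) else 0) 1
    (fun k => by split_ifs <;> simp)‖ ≤ 1 :=
  (BoundedContinuousFunction.norm_le zero_le_one).2 fun k => by
    simp only [BoundedContinuousFunction.coe_ofNormedAddCommGroupDiscrete]
    split_ifs <;> simp

lemma powFamily_apply {n : ℕ} {s : ℝ} (hs : 0 < s) (i : Fin n) {w : ℂ} (hw : ‖w‖ < s)
    (k : Fin n → ℕ) : powFamily s i w k = (w / s) ^ k i := by
  have hsum : Summable fun m : ℕ =>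
      (w / s) ^ m • BoundedContinuousFunction.ofNormedAddCommGroupDiscrete
      (fun k : Fin n → ℕ => if k i = m then (1 : ℂ) else 0) 1
      (fun k => by split_ifs <;> simp) := by
    refine .of_norm_bounded (summable_geometric_of_lt_one (r := ‖w‖ / s) (by positivity)
      ((div_lt_one hs).2 hw)) fun m => ?_
    rw [norm_smul, norm_pow, norm_div, Complex.norm_real, Real.norm_of_nonneg hs.le]
    exact mul_le_of_le_one_right (by positivity) (norm_indicator_le i m)
  have h := hsum.hasSum.mapL (BoundedContinuousFunction.evalCLM ℂ k)
  have h2 : powFamily s i w k = BoundedContinuousFunction.evalCLM ℂ k (powFamily s i w) := rfl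
  rw [h2, powFamily, ← h.tsum_eq, tsum_eq_single (k i)]
  · simp
  · intro m hm
    simp [hm.symm]

lemma powFamily_analyticAt {n : ℕ} {s : ℝ} (hs : 0 < s) (i : Fin n) {w : ℂ} (hw : ‖w‖ < s) :
    AnalyticAt ℂ (powFamily s i) w := by
  obtain ⟨r, hr, hrs⟩ := exists_between hw
  have hr0 : 0 < r := (norm_nonneg _).trans_lt hr
  have hd : DifferentiableOn ℂ (powFamily s i) (Metric.ball 0 r) := by
    refine Complex.differentiableOn_tsum_of_summable_norm
      (summable_geometric_of_lt_one (r := r / s) (by positivity) ((div_lt_one hs).2 hrs))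
      (fun m => ?_) Metric.isOpen_ball fun m v hv => ?_
    · exact ((differentiable_id.div_const _).pow m).differentiableOn.smul_const _
    · rw [norm_smul, norm_pow, norm_div, Complex.norm_real, Real.norm_of_nonneg hs.le]
      refine (mul_le_of_le_one_right (by positivity) (norm_indicator_le i m)).trans ?_
      have : ‖v‖ ≤ r := (mem_ball_zero_iff.1 hv).le
      gcongr
  exact hd.analyticAt (Metric.isOpen_ball.mem_nhds (by simpa using hr))

lemma series_analyticOnNhd [CompleteSpace E] {n : ℕ} {a : (Fin n → ℕ) → E}
    (h : ∀ r : ℝ, 0 ≤ r → r < 1 → Summable fun k => ‖a k‖ * r ^ (∑ i, k i)) :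
    AnalyticOnNhd ℂ (fun z => ∑' k, mon k z • a k) (polydisc n) := by
  intro z hz
  obtain ⟨r, hr0, hr1, hr⟩ := exists_radius hz
  obtain ⟨s, hrs, hs1⟩ := exists_between hr1
  have hs : 0 < s := hr0.trans_lt hrs
  have hsum := h s hs.le hs1
  have hb : ∀ x : BoundedContinuousFunction (Fin n → ℕ) ℂ, ∀ k,
      ‖x k • ((s : ℂ) ^ (∑ i, k i)) • a k‖ ≤ ‖x‖ * (‖a k‖ * s ^ (∑ i, k i)) := by
    intro x k
    rw [norm_smul, norm_smul, norm_pow, Complex.norm_real, Real.norm_of_nonneg hs.le,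
      mul_comm (s ^ _)]
    exact mul_le_mul_of_nonneg_right (x.norm_coe_le_norm k) (by positivity)
  have hbs : ∀ x : BoundedContinuousFunction (Fin n → ℕ) ℂ,
      Summable fun k => x k • ((s : ℂ) ^ (∑ i, k i)) • a k := fun x =>
    .of_norm_bounded (hsum.mul_left ‖x‖) (hb x)
  let L : BoundedContinuousFunction (Fin n → ℕ) ℂ →L[ℂ] E := LinearMap.mkContinuous
    { toFun := fun x => ∑' k, x k • ((s : ℂ) ^ (∑ i, k i)) • a k
      map_add' := fun x y => by
        rw [← (hbs x).tsum_add (hbs y)]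
        exact tsum_congr fun k => by simp [add_smul]
      map_smul' := fun c x => by
        rw [RingHom.id_apply, ← (hbs x).tsum_const_smul]
        exact tsum_congr fun k => by simp [smul_smul, mul_assoc] }
    (∑' k, ‖a k‖ * s ^ (∑ i, k i)) (fun x => by
      change ‖∑' k, x k • ((s : ℂ) ^ (∑ i, k i)) • a k‖ ≤ _
      refine (tsum_of_norm_bounded (hsum.hasSum.mul_left ‖x‖) (hb x)).trans ?_
      rw [mul_comm])
  have hP : AnalyticAt ℂ (fun z : Fin n → ℂ => ∏ i, powFamily s i (z i)) z := by
    refine Finset.analyticAt_fun_prod _ fun i _ => ?_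
    exact (powFamily_analyticAt hs i ((hr i).trans_lt hrs)).comp (f := fun z : Fin n → ℂ => z i)
      ((ContinuousLinearMap.proj (R := ℂ) (φ := fun _ : Fin n => ℂ) i).analyticAt z)
  refine ((L.analyticAt _).comp hP).congr ?_
  have hU : {z : Fin n → ℂ | ∀ i, ‖z i‖ < s} ∈ 𝓝 z := by
    refine IsOpen.mem_nhds ?_ fun i => (hr i).trans_lt hrs
    simp only [Set.ofPred_forall]
    exact isOpen_iInter_of_finite fun i => isOpen_lt (by fun_prop) continuous_const
  filter_upwards [hU] with v hv
  change ∑' k, (∏ i, powFamily s i (v i)) k • ((s : ℂ) ^ (∑ i, k i)) • a k = _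
  refine tsum_congr fun k => ?_
  have : (∏ i, powFamily s i (v i)) k = ∏ i, powFamily s i (v i) k := by
    rw [BoundedContinuousFunction.coe_prod, Finset.prod_apply]
  rw [this, smul_smul]
  congr 1
  have hs' : (s : ℂ) ≠ 0 := by exact_mod_cast hs.ne'
  simp_rw [powFamily_apply hs _ (hv _)]
  rw [← Finset.prod_pow_eq_pow_sum, ← Finset.prod_mul_distrib]
  refine Finset.prod_congr rfl fun i _ => ?_
  rw [div_pow, div_mul_cancel₀ _ (pow_ne_zero _ hs')]

end Taylor

lemma isLUB_means {ι : Type*} {b : ι → ℝ} (hb : ∀ k, 0 ≤ b k) (d : ι → ℕ) {m : ℝ → ℝ}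
    (h : ∀ r : ℝ, 0 ≤ r → r < 1 → HasSum (fun k => b k * (r ^ d k) ^ 2) (m r)) :
    (BddAbove (Set.range fun r : Set.Ico (0 : ℝ) 1 => m r) ↔ Summable b) ∧
      (Summable b → ⨆ r : Set.Ico (0 : ℝ) 1, m r = ∑' k, b k) := by
  have low : ∀ U, (∀ r : Set.Ico (0 : ℝ) 1, m r ≤ U) → ∀ s : Finset ι, ∑ k ∈ s, b k ≤ U := by
    intro U hU s
    have ht : Tendsto (fun r : ℝ => ∑ k ∈ s, b k * (r ^ d k) ^ 2) (𝓝[<] 1)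
        (𝓝 (∑ k ∈ s, b k * ((1 : ℝ) ^ d k) ^ 2)) :=
      (Continuous.tendsto (by fun_prop) _).mono_left nhdsWithin_le_nhds
    simp only [one_pow, mul_one] at ht
    refine le_of_tendsto ht ?_
    filter_upwards [Ioo_mem_nhdsLT (zero_lt_one (α := ℝ))] with r hr
    exact (sum_le_hasSum s (fun k _ => mul_nonneg (hb k) (by positivity))
      (h r hr.1.le hr.2)).trans (hU ⟨r, hr.1.le, hr.2⟩)
  have up : Summable b → ∀ r : Set.Ico (0 : ℝ) 1, m r ≤ ∑' k, b k := by
    intro hs r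
    refine hasSum_le (fun k => ?_) (h r r.2.1 r.2.2) hs.hasSum
    exact mul_le_of_le_one_right (hb k) (pow_le_one₀ (pow_nonneg r.2.1 _)
      (pow_le_one₀ r.2.1 r.2.2.le))
  have : Nonempty (Set.Ico (0 : ℝ) 1) := ⟨⟨0, by simp⟩⟩
  refine ⟨⟨fun ⟨U, hU⟩ => summable_of_sum_le hb (low U fun r => hU ⟨r, rfl⟩),
    fun hs => ⟨_, by rintro _ ⟨r, rfl⟩; exact up hs r⟩⟩, fun hs => ?_⟩
  refine le_antisymm (ciSup_le (up hs)) (hs.tsum_le_of_sum_le (low _ fun r => ?_))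
  exact le_ciSup (f := fun r : Set.Ico (0 : ℝ) 1 => m r)
    ⟨_, by rintro _ ⟨r, rfl⟩; exact up hs r⟩ r

section Hardy

lemma summable_of_sq {n : ℕ} {E : Type*} [NormedAddCommGroup E] {a : (Fin n → ℕ) → E} (ha : Summable fun k => ‖a k‖ ^ 2) {r : ℝ} (hr : 0 ≤ r)
    (hr1 : r < 1) : Summable fun k => ‖a k‖ * r ^ (∑ i, k i) := by
  refine summable_of_bound (s := 1) (M := √(∑' k, ‖a k‖ ^ 2)) hr hr1 fun k => ?_
  rw [one_pow, mul_one]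
  exact Real.le_sqrt_of_sq_le (ha.le_tsum k fun _ _ => by positivity)

lemma sq_summable {n : ℕ} {E : Type*} [NormedAddCommGroup E]
    (a : lp (fun _ : Fin n → ℕ => E) 2) : Summable fun k => ‖a k‖ ^ 2 := by
  have h := (lp.memℓp a).summable (by norm_num)
  simpa using h

lemma hardyMean_nonneg {n : ℕ} {E : Type*} [NormedAddCommGroup E] (f : (Fin n → ℂ) → E) (r : ℝ) :
    0 ≤ hardyMean f r :=
  integral_nonneg fun _ => by positivity

variable {n : ℕ} {E : Type*} [NormedAddCommGroup E] [InnerProductSpace ℂ E]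

lemma integrable_sq {f : (Fin n → ℂ) → E} (hf : AnalyticOnNhd ℂ f (polydisc n)) {r : ℝ}
    (hr : r ∈ Set.Ico (0 : ℝ) 1) :
    Integrable (fun t => ‖f (torusPoint r t)‖ ^ 2) (torusMeasure n) := by
  refine Continuous.integrable_of_hasCompactSupport ?_ (HasCompactSupport.of_compactSpace _)
  have h := hf.continuousOn.comp_continuous (continuous_torusPoint r)
    fun t => torusPoint_mem hr.1 hr.2 t
  exact h.norm.pow 2

lemma hardyMean_le {F : Type*} [NormedAddCommGroup F] [InnerProductSpace ℂ F]
    {f : (Fin n → ℂ) → E} (hf : AnalyticOnNhd ℂ f (polydisc n)) {g : (Fin n → ℂ) → F} {C : ℝ}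
    (h : ∀ z ∈ polydisc n, ‖g z‖ ≤ C * ‖f z‖) {r : ℝ} (hr : r ∈ Set.Ico (0 : ℝ) 1) :
    hardyMean g r ≤ C ^ 2 * hardyMean f r := by
  rw [hardyMean, hardyMean, ← integral_const_mul]
  refine integral_mono_of_nonneg (.of_forall fun t => by positivity)
    ((integrable_sq hf hr).const_mul _) (.of_forall fun t => ?_)
  change ‖g (torusPoint r t)‖ ^ 2 ≤ C ^ 2 * ‖f (torusPoint r t)‖ ^ 2
  rw [← mul_pow]
  exact pow_le_pow_left₀ (norm_nonneg _) (h _ (torusPoint_mem hr.1 hr.2 t)) 2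

lemma hardyMean_add_le {f g : (Fin n → ℂ) → E} (hf : AnalyticOnNhd ℂ f (polydisc n))
    (hg : AnalyticOnNhd ℂ g (polydisc n)) {r : ℝ} (hr : r ∈ Set.Ico (0 : ℝ) 1) :
    hardyMean (f + g) r ≤ 2 * hardyMean f r + 2 * hardyMean g r := by
  simp only [hardyMean]
  rw [← integral_const_mul, ← integral_const_mul,
    ← integral_add ((integrable_sq hf hr).const_mul _) ((integrable_sq hg hr).const_mul _)]
  refine integral_mono_of_nonneg (.of_forall fun t => by positivity)
    (((integrable_sq hf hr).const_mul _).add ((integrable_sq hg hr).const_mul _))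
    (.of_forall fun t => ?_)
  change ‖f (torusPoint r t) + g (torusPoint r t)‖ ^ 2 ≤ _
  have h1 := norm_add_le (f (torusPoint r t)) (g (torusPoint r t))
  nlinarith [sq_nonneg (‖f (torusPoint r t)‖ - ‖g (torusPoint r t)‖),
    norm_nonneg (f (torusPoint r t) + g (torusPoint r t)),
    norm_nonneg (f (torusPoint r t)), norm_nonneg (g (torusPoint r t))]

variable (n E) in
/-- The vector space of `E`-valued analytic functions on the polydisc with bounded integral means.
A function on the polydisc is represented by its extension by zero. -/
def hardySubmodule : Submodule ℂ ((Fin n → ℂ) → E) where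
  carrier := {f | AnalyticOnNhd ℂ f (polydisc n) ∧
    BddAbove (Set.range fun r : Set.Ico (0 : ℝ) 1 => hardyMean f r) ∧
    ∀ z, z ∉ polydisc n → f z = 0}
  zero_mem' := ⟨analyticOnNhd_const, ⟨0, by rintro _ ⟨r, rfl⟩; simp [hardyMean]⟩, fun _ _ => rfl⟩
  add_mem' := by
    rintro f g ⟨hf, ⟨A, hA⟩, hf0⟩ ⟨hg, ⟨B, hB⟩, hg0⟩
    refine ⟨hf.add hg, ⟨2 * A + 2 * B, ?_⟩, fun z hz => by simp [hf0 z hz, hg0 z hz]⟩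
    rintro _ ⟨r, rfl⟩
    have h1 := hA ⟨r, rfl⟩
    have h2 := hB ⟨r, rfl⟩
    have h3 := hardyMean_add_le hf hg r.2
    simp only at h1 h2 ⊢
    linarith
  smul_mem' := by
    rintro c f ⟨hf, ⟨A, hA⟩, hf0⟩
    refine ⟨fun z hz => analyticAt_const.smul (hf z hz), ⟨‖c‖ ^ 2 * A, ?_⟩,
      fun z hz => by simp [hf0 z hz]⟩
    rintro _ ⟨r, rfl⟩
    exact (hardyMean_le hf (g := c • f) (C := ‖c‖) (fun z _ => (norm_smul c (f z)).le) r.2).trans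
      (mul_le_mul_of_nonneg_left (hA ⟨r, rfl⟩) (by positivity))

variable (n E) in
/-- The Hardy space `H²_E(𝔻ⁿ)`. -/
def HardySpace : Type _ := hardySubmodule n E

namespace HardySpace

instance : AddCommGroup (HardySpace n E) := inferInstanceAs (AddCommGroup (hardySubmodule n E))

instance : Module ℂ (HardySpace n E) := inferInstanceAs (Module ℂ (hardySubmodule n E))

instance : FunLike (HardySpace n E) (Fin n → ℂ) E where
  coe f := f.1
  coe_injective _ _ h := Subtype.ext h

lemma analytic (f : HardySpace n E) : AnalyticOnNhd ℂ f (polydisc n) := f.2.1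

lemma bddAbove (f : HardySpace n E) :
    BddAbove (Set.range fun r : Set.Ico (0 : ℝ) 1 => hardyMean f r) := f.2.2.1

lemma eq_zero (f : HardySpace n E) {z : Fin n → ℂ} (hz : z ∉ polydisc n) : f z = 0 := f.2.2.2 z hz

@[simp] lemma add_apply (f g : HardySpace n E) (z : Fin n → ℂ) : (f + g) z = f z + g z := rfl

@[simp] lemma smul_apply (c : ℂ) (f : HardySpace n E) (z : Fin n → ℂ) : (c • f) z = c • f z := rfl

@[simp] lemma zero_apply (z : Fin n → ℂ) : (0 : HardySpace n E) z = 0 := rfl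

lemma ext_polydisc {f g : HardySpace n E} (h : ∀ z ∈ polydisc n, f z = g z) : f = g := by
  refine DFunLike.ext _ _ fun z => ?_
  by_cases hz : z ∈ polydisc n
  · exact h z hz
  · rw [f.eq_zero hz, g.eq_zero hz]

/-- The Hardy norm `‖f‖ = (sup_{0 ≤ r < 1} ∫_{𝕋ⁿ} ‖f(r z)‖² dm(z))^{1/2}`. -/
instance : Norm (HardySpace n E) :=
  ⟨fun f => √(⨆ r : Set.Ico (0 : ℝ) 1, hardyMean f r)⟩

lemma norm_def (f : HardySpace n E) : ‖f‖ = √(⨆ r : Set.Ico (0 : ℝ) 1, hardyMean f r) := rfl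

lemma hardyMean_le_norm (f : HardySpace n E) {r : ℝ} (hr : r ∈ Set.Ico (0 : ℝ) 1) :
    hardyMean f r ≤ ‖f‖ ^ 2 := by
  have h := le_ciSup f.bddAbove ⟨r, hr⟩
  rw [norm_def, Real.sq_sqrt ((hardyMean_nonneg f r).trans h)]
  exact h

lemma norm_le_of_hardyMean_le {f : HardySpace n E} {C : ℝ} (hC : 0 ≤ C)
    (h : ∀ r ∈ Set.Ico (0 : ℝ) 1, hardyMean f r ≤ C ^ 2) : ‖f‖ ≤ C := by
  have : Nonempty (Set.Ico (0 : ℝ) 1) := ⟨⟨0, by simp⟩⟩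
  rw [norm_def]
  exact Real.sqrt_le_iff.2 ⟨hC, ciSup_le fun r => h r r.2⟩

variable [CompleteSpace E]

lemma hasSum_series {a : (Fin n → ℕ) → E}
    (ha : ∀ r : ℝ, 0 ≤ r → r < 1 → Summable fun k => ‖a k‖ * r ^ (∑ i, k i))
    {z : Fin n → ℂ} (hz : z ∈ polydisc n) :
    HasSum (fun k => mon k z • a k) (∑' k, mon k z • a k) := by
  obtain ⟨r, hr0, hr1, hr⟩ := exists_radius hz
  refine (Summable.of_norm_bounded (ha r hr0 hr1) fun k => ?_).hasSum
  rw [norm_smul, mul_comm]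
  exact mul_le_mul_of_nonneg_left (norm_mon_le k _ hr) (norm_nonneg _)

/-- The function `z ↦ ∑ₖ zᵏ aₖ` in `H²_E(𝔻ⁿ)` with square summable coefficients `a`. -/
def series (a : lp (fun _ : Fin n → ℕ => E) 2) : HardySpace n E :=
  ⟨(polydisc n).indicator fun z => ∑' k, mon k z • a k, by
    have hs := fun r hr hr1 => summable_of_sq (sq_summable a) (r := r) hr hr1
    have hon : ∀ z ∈ polydisc n, (polydisc n).indicator (fun z => ∑' k, mon k z • a k) z =
        ∑' k, mon k z • a k := fun z hz => Set.indicator_of_mem hz _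
    refine ⟨(series_analyticOnNhd hs).congr (isOpen_polydisc n) fun z hz => (hon z hz).symm, ?_,
      fun z hz => Set.indicator_of_notMem hz _⟩
    exact (isLUB_means (fun k => by positivity) _
      fun r hr hr1 => hasSum_hardyMean hr hr1 (hs r hr hr1) hon).1.2 (sq_summable a)⟩

lemma hasSum_apply_series (a : lp (fun _ : Fin n → ℕ => E) 2) {z : Fin n → ℂ}
    (hz : z ∈ polydisc n) : HasSum (fun k => mon k z • a k) (series a z) := by
  have h := hasSum_series (fun r hr hr1 => summable_of_sq (sq_summable a) hr hr1) hz
  have e : series a z = ∑' k, mon k z • a k :=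
    Set.indicator_of_mem hz (fun z => ∑' k, mon k z • a k)
  rwa [e]

variable (n E) in
/-- The linear map that sends square summable coefficients to the corresponding power series. -/
def ofCoeff : lp (fun _ : Fin n → ℕ => E) 2 →ₗ[ℂ] HardySpace n E where
  toFun := series
  map_add' a b := by
    refine ext_polydisc fun z hz => (hasSum_apply_series _ hz).unique ?_
    refine ((hasSum_apply_series a hz).add (hasSum_apply_series b hz)).congr_fun fun k => ?_
    simp
  map_smul' c a := by
    refine ext_polydisc fun z hz => (hasSum_apply_series _ hz).unique ?_
    refine ((hasSum_apply_series a hz).const_smul c).congr_fun fun k => ?_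
    exact smul_comm (mon k z) c (a k)

lemma hasSum_ofCoeff (a : lp (fun _ : Fin n → ℕ => E) 2) {z : Fin n → ℂ} (hz : z ∈ polydisc n) :
    HasSum (fun k => mon k z • a k) (ofCoeff n E a z) := hasSum_apply_series a hz

lemma norm_ofCoeff (a : lp (fun _ : Fin n → ℕ => E) 2) : ‖ofCoeff n E a‖ = ‖a‖ := by
  have h := (isLUB_means (b := fun k => ‖a k‖ ^ 2) (fun k => by positivity) _
      fun r hr hr1 => hasSum_hardyMean (f := ofCoeff n E a) hr hr1
        (summable_of_sq (sq_summable a) hr hr1)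
        fun z hz => (hasSum_ofCoeff a hz).tsum_eq.symm).2 (sq_summable a)
  rw [norm_def, h]
  have h2 := lp.norm_rpow_eq_tsum (p := 2) (by norm_num) a
  simp only [ENNReal.toReal_ofNat, Real.rpow_ofNat] at h2
  rw [← h2, Real.sqrt_sq (norm_nonneg _)]

lemma ofCoeff_surjective : Function.Surjective (ofCoeff n E) := by
  intro f
  obtain ⟨a, ha1, ha2⟩ := exists_taylor n f f.analytic
  have hs : ∀ r : ℝ, 0 ≤ r → r < 1 → Summable fun k => ‖a k‖ * r ^ (∑ i, k i) := by
    intro r hr hr1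
    obtain ⟨s, hrs, hs1⟩ := exists_between hr1
    obtain ⟨M, hM⟩ := exists_bound f.analytic hs1
    exact summable_of_bound hr hrs (ha1 s (hr.trans_lt hrs) hs1 M hM)
  have hsq : Summable fun k => ‖a k‖ ^ 2 := (isLUB_means (fun k => by positivity) _
    fun r hr hr1 => hasSum_hardyMean hr hr1 (hs r hr hr1)
      fun z hz => (ha2 z hz).tsum_eq.symm).1.1 f.bddAbove
  let b : lp (fun _ : Fin n → ℕ => E) 2 := ⟨a, memℓp_gen (by simpa using hsq)⟩
  exact ⟨b, ext_polydisc fun z hz => (hasSum_ofCoeff b hz).unique (ha2 z hz)⟩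

lemma normedSpaceCore : NormedSpace.Core ℂ (HardySpace n E) where
  norm_nonneg f := Real.sqrt_nonneg _
  norm_smul c f := by
    obtain ⟨a, rfl⟩ := ofCoeff_surjective f
    rw [← map_smul, norm_ofCoeff, norm_ofCoeff, norm_smul]
  norm_triangle f g := by
    obtain ⟨a, rfl⟩ := ofCoeff_surjective f
    obtain ⟨b, rfl⟩ := ofCoeff_surjective g
    rw [← map_add, norm_ofCoeff, norm_ofCoeff, norm_ofCoeff]
    exact norm_add_le a b
  norm_eq_zero_iff f := by
    obtain ⟨a, rfl⟩ := ofCoeff_surjective f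
    rw [norm_ofCoeff, norm_eq_zero]
    refine ⟨fun h => by rw [h, map_zero], fun h => ?_⟩
    rw [← norm_eq_zero, ← norm_ofCoeff, h, norm_def]
    simp [hardyMean]

instance : NormedAddCommGroup (HardySpace n E) := NormedAddCommGroup.ofCore normedSpaceCore

instance : NormedSpace ℂ (HardySpace n E) := NormedSpace.ofCore normedSpaceCore

/-- The inner product of the Hardy space, the one that polarizes the Hardy norm. -/
instance : InnerProductSpace ℂ (HardySpace n E) :=
  InnerProductSpace.ofNorm ℂ fun f g => by
    obtain ⟨a, rfl⟩ := ofCoeff_surjective f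
    obtain ⟨b, rfl⟩ := ofCoeff_surjective g
    rw [← map_add, ← map_sub, norm_ofCoeff, norm_ofCoeff, norm_ofCoeff, norm_ofCoeff]
    simp only [← pow_two]
    exact parallelogram_law_with_norm ℂ a b

variable (n E) in
/-- The Hardy space is isometric to the space of square summable families of coefficients. -/
def coeffIso : lp (fun _ : Fin n → ℕ => E) 2 ≃ₗᵢ[ℂ] HardySpace n E :=
  LinearIsometryEquiv.ofSurjective ⟨ofCoeff n E, norm_ofCoeff⟩ ofCoeff_surjective

instance : CompleteSpace (HardySpace n E) :=
  (coeffIso n E).toIsometryEquiv.symm.completeSpace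

end HardySpace

end Hardy

section Operators
variable {n : ℕ} {E F : Type*} [NormedAddCommGroup E] [InnerProductSpace ℂ E] [CompleteSpace E]
  [NormedAddCommGroup F] [InnerProductSpace ℂ F] [CompleteSpace F]

/-- The bounded analytic functions on the polydisc with values in the bounded operators `E → F`,
that is `H^∞_{B(E, F)}(𝔻ⁿ)`. Values outside the polydisc are irrelevant. -/
structure HInfty (n : ℕ) (E F : Type*) [NormedAddCommGroup E] [InnerProductSpace ℂ E]
    [NormedAddCommGroup F] [InnerProductSpace ℂ F] where
  toFun : (Fin n → ℂ) → E →L[ℂ] F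
  analytic : AnalyticOnNhd ℂ toFun (polydisc n)
  bounded : ∃ C, ∀ z ∈ polydisc n, ‖toFun z‖ ≤ C

/-- The multiplication operator `M_Θ f = Θ f` from `H²_E(𝔻ⁿ)` to `H²_F(𝔻ⁿ)`. -/
def HInfty.mulOp (Θ : HInfty n E F) : HardySpace n E →L[ℂ] HardySpace n F :=
  LinearMap.mkContinuousOfExistsBound
    { toFun := fun f => ⟨fun z => Θ.toFun z (f z), by
        refine ⟨fun z hz => ?_, ?_, fun z hz => by simp only [f.eq_zero hz, map_zero]⟩
        · exact ((ContinuousLinearMap.id ℂ (E →L[ℂ] F)).analyticAt_bilinear _).comp₂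
            (Θ.analytic z hz) (f.analytic z hz)
        · obtain ⟨C, hC⟩ := Θ.bounded
          obtain ⟨A, hA⟩ := f.bddAbove
          refine ⟨C ^ 2 * A, ?_⟩
          rintro _ ⟨r, rfl⟩
          exact (hardyMean_le f.analytic (fun z hz => (Θ.toFun z).le_of_opNorm_le (hC z hz) _)
            r.2).trans (mul_le_mul_of_nonneg_left (hA ⟨r, rfl⟩) (by positivity))⟩
      map_add' := fun f g => HardySpace.ext_polydisc fun z _ => map_add (Θ.toFun z) (f z) (g z)
      map_smul' := fun c f => HardySpace.ext_polydisc fun z _ => map_smul (Θ.toFun z) c (f z) }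
    (by
      obtain ⟨C, hC⟩ := Θ.bounded
      refine ⟨|C|, fun f => HardySpace.norm_le_of_hardyMean_le (by positivity) fun r hr => ?_⟩
      refine (hardyMean_le f.analytic
        (fun z hz => (Θ.toFun z).le_of_opNorm_le (hC z hz) _) hr).trans ?_
      rw [mul_pow, sq_abs]
      exact mul_le_mul_of_nonneg_left (f.hardyMean_le_norm hr) (by positivity))

@[simp] lemma HInfty.mulOp_apply (Θ : HInfty n E F) (f : HardySpace n E) (z : Fin n → ℂ) :
    Θ.mulOp f z = Θ.toFun z (f z) := rfl

/-- `Θ` is inner if `f ↦ Θ f` is an isometry of Hardy spaces. -/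
def HInfty.IsInner (Θ : HInfty n E F) : Prop := Isometry Θ.mulOp

variable (E) in
/-- The bounded analytic function `z ↦ zᵢ I_E`. -/
def coordinate (i : Fin n) : HInfty n E E where
  toFun z := z i • ContinuousLinearMap.id ℂ E
  analytic z _ := AnalyticAt.smul
    ((ContinuousLinearMap.proj (R := ℂ) (φ := fun _ : Fin n => ℂ) i).analyticAt z) analyticAt_const
  bounded := ⟨1, fun z hz => by
    rw [norm_smul]
    exact mul_le_one₀ (hz i).le (norm_nonneg _) ContinuousLinearMap.norm_id_le⟩

/-- The multiplication operator `M_{zᵢ}` on `H²_E(𝔻ⁿ)`. -/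
def Mz (i : Fin n) : HardySpace n E →L[ℂ] HardySpace n E := (coordinate E i).mulOp

@[simp] lemma Mz_apply (i : Fin n) (f : HardySpace n E) (z : Fin n → ℂ) :
    Mz i f z = z i • f z := rfl

instance (Q : ClosedSubmodule ℂ (HardySpace n E)) : CompleteSpace Q.toSubmodule :=
  Q.isClosed.completeSpace_coe

/-- A closed subspace is a quotient module if it is invariant under every `M_{zᵢ}^*`. -/
def IsQuotientModule (Q : ClosedSubmodule ℂ (HardySpace n E)) : Prop :=
  ∀ i : Fin n, ∀ f ∈ Q, ContinuousLinearMap.adjoint (Mz i) f ∈ Q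

/-- The module operator `C_{zᵢ} = P_Q M_{zᵢ}|_Q` on `Q`. -/
def compression (Q : ClosedSubmodule ℂ (HardySpace n E)) (i : Fin n) :
    Q.toSubmodule →L[ℂ] Q.toSubmodule :=
  Q.toSubmodule.orthogonalProjectionOnto ∘L Mz i ∘L Q.toSubmodule.subtypeL

/-- `Q` is a Beurling quotient module: `Q = H²_E(𝔻ⁿ) ⊖ Θ H²_{E_*}(𝔻ⁿ)` for some separable complex
Hilbert space `E_*` and some inner function `Θ ∈ H^∞_{B(E_*, E)}(𝔻ⁿ)`. -/
def IsBeurlingQuotientModule {E : Type u} [NormedAddCommGroup E] [InnerProductSpace ℂ E]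
    [CompleteSpace E] (Q : ClosedSubmodule ℂ (HardySpace n E)) : Prop :=
  ∃ (Es : Type u) (_ : NormedAddCommGroup Es) (_ : InnerProductSpace ℂ Es) (_ : CompleteSpace Es)
    (_ : TopologicalSpace.SeparableSpace Es) (Θ : HInfty n Es E),
    Θ.IsInner ∧ Q.toSubmodule = (LinearMap.range Θ.mulOp.toLinearMap)ᗮ

end Operators

end Polydisc

end

/-! Put `S = Qᗮ`. Since `Q` is invariant under the adjoints of the shifts `M_i`, `S` is invariant
under the `M_i`; let `R_i = M_i|_S`. Both conditions turn out to say that the isometries `R_i`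
doubly commute: `R_j† R_i = R_i R_j†` for `i ≠ j`.

Condition 2. Let `B_i = P_S M_i|_Q` (`corner`). As `M_i` is isometric, `I - C_i† C_i = B_i† B_i`
(`one_sub_compression`), so the product in condition 2 vanishes iff `B_i†` and `B_j†` have
orthogonal ranges (`mul_eq_zero_iff`). The shifts doubly commute on the whole Hardy space, so `⟨R_j†
R_i s, t⟩ = ⟨M_j† s, M_i† t⟩` for `s, t` in `S`. Splitting the right side along `Q ⊕ S` gives `⟨B_j†
s, B_i† t⟩ + ⟨R_i R_j† s, t⟩`. The first term is thus exactly the defect of double commutation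
(`mul_eq_zero_iff_doubly_comm`).

Condition 1. If `S` is the range of `M_Θ` with `Θ` inner, then `M_Θ` is a unitary onto `S` that
intertwines the shifts with the `R_i`, and double commutation is carried over
(`doubly_comm_of_inner`). Conversely, doubly commuting pure isometries have a Wold decomposition:
`S` is the closed orthogonal sum of the `z^k W`, where `W` is the joint kernel of the `R_i†`
(`IsDoublyCommutingShift.eq_zero_of_inner_monomial`). The isometry from `H²_W` that takes `z^k w` to
`z^k` times the function `w` is multiplication by `Θ(z) w = w(z)` (`exists_inner_of_orthogonal`),
and its range is `S`. -/

noncomputable section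

/-! ### Wold decomposition for doubly commuting pure isometries. -/

section Wold

open ContinuousLinearMap

variable {ι K : Type*} [NormedAddCommGroup K] [InnerProductSpace ℂ K] [CompleteSpace K]

lemma exists_eq_add_single [DecidableEq ι] {k : ι → ℕ} {i : ι} (h : k i ≠ 0) :
    ∃ l : ι → ℕ, k = l + Pi.single i 1 := by
  refine ⟨k - Pi.single i 1, ?_⟩
  ext j
  by_cases hj : j = i
  · subst hj
    simp only [Pi.add_apply, Pi.sub_apply, Pi.single_eq_same]
    omega
  · simp [hj]

/-- The monomials `V k` are known only through `V 0` and the effect of raising one exponent, so this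
is the induction that reaches all of them. -/
lemma multiIndex_induction [Fintype ι] [DecidableEq ι] {P : (ι → ℕ) → Prop} (zero : P 0)
    (add_single : ∀ k i, P k → P (k + Pi.single i 1)) (k : ι → ℕ) : P k := by
  induction hm : ∑ i, k i generalizing k with
  | zero =>
    have : k = 0 := funext fun i => Finset.sum_eq_zero_iff.1 hm i (Finset.mem_univ i)
    exact this ▸ zero
  | succ m ih =>
    obtain ⟨i, -, hi⟩ : ∃ i ∈ Finset.univ, k i ≠ 0 :=
      Finset.exists_ne_zero_of_sum_ne_zero (by omega)
    obtain ⟨l, rfl⟩ := exists_eq_add_single hi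
    refine add_single l i (ih l ?_)
    simpa [Finset.sum_add_distrib] using hm

/-- A commuting family of pure isometries `T i` such that `T i†` commutes with `T j` for `i ≠ j`,
together with its monomials `V k = ∏ i, T i ^ k i`. -/
structure IsDoublyCommutingShift [DecidableEq ι] (T : ι → K →L[ℂ] K) (V : (ι → ℕ) → K →L[ℂ] K) :
    Prop where
  zero : ∀ x, V 0 x = x
  add_single : ∀ k i x, V (k + Pi.single i 1) x = T i (V k x)
  isometry : ∀ i x, adjoint (T i) (T i x) = x
  comm : ∀ i j x, T i (T j x) = T j (T i x)
  doubly_comm : ∀ i j, i ≠ j → ∀ x, adjoint (T i) (T j x) = T j (adjoint (T i) x)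
  pure : ∀ i x, (∀ m : ℕ, ∃ y, x = (T i)^[m] y) → x = 0

/-- The joint kernel of the adjoints of the operators `T i`. -/
def wanderingSubspace (T : ι → K →L[ℂ] K) : Submodule ℂ K :=
  ⨅ i, LinearMap.ker (adjoint (T i)).toLinearMap

lemma mem_wanderingSubspace {T : ι → K →L[ℂ] K} {w : K} :
    w ∈ wanderingSubspace T ↔ ∀ i, adjoint (T i) w = 0 := by
  simp [wanderingSubspace]

lemma isClosed_wanderingSubspace {T : ι → K →L[ℂ] K} :
    IsClosed (wanderingSubspace T : Set K) := by
  have e : (wanderingSubspace T : Set K) = ⋂ i, {w | adjoint (T i) w = 0} := by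
    ext w
    simp [mem_wanderingSubspace]
  rw [e]
  exact isClosed_iInter fun i => isClosed_eq (adjoint (T i)).continuous continuous_const

namespace IsDoublyCommutingShift

variable [DecidableEq ι] {T : ι → K →L[ℂ] K} {V : (ι → ℕ) → K →L[ℂ] K}

lemma adjoint_comm (hT : IsDoublyCommutingShift T V) (i j : ι) (x : K) :
    adjoint (T i) (adjoint (T j) x) = adjoint (T j) (adjoint (T i) x) := by
  refine ext_inner_right ℂ fun y => ?_
  simp only [adjoint_inner_left, hT.comm]

lemma inner_apply_apply (hT : IsDoublyCommutingShift T V) (i : ι) (x y : K) :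
    inner ℂ (T i x) (T i y) = inner ℂ x y := by
  rw [← adjoint_inner_left, hT.isometry]

/-- The monomial has no factor `T i`, so `T i†` commutes past all its factors and reaches `w`, which
it kills. -/
lemma adjoint_monomial_eq_zero [Fintype ι] (hT : IsDoublyCommutingShift T V) {w : K}
    (hw : w ∈ wanderingSubspace T) {i : ι} (k : ι → ℕ) (hk : k i = 0) :
    adjoint (T i) (V k w) = 0 := by
  induction k using multiIndex_induction with
  | zero => rw [hT.zero, mem_wanderingSubspace.1 hw]
  | add_single k j ih =>
    have hij : i ≠ j := by
      rintro rfl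
      simp at hk
    rw [hT.add_single, hT.doubly_comm i j hij, ih (by simpa [hij] using hk), map_zero]

/-- Cancel the isometry `T i` on both sides until none is left on the left. One remains on the
right; moved across as `T i†`, it kills the left vector. -/
lemma inner_monomial_of_lt [Fintype ι] (hT : IsDoublyCommutingShift T V) {w w' : K}
    (hw : w ∈ wanderingSubspace T) {k l : ι → ℕ} {i : ι} (h : k i < l i) :
    inner ℂ (V k w) (V l w') = 0 := by
  induction hm : k i generalizing k l with
  | zero =>
    obtain ⟨l, rfl⟩ := exists_eq_add_single (Nat.ne_zero_of_lt h)
    rw [hT.add_single, ← adjoint_inner_left, hT.adjoint_monomial_eq_zero hw k hm, inner_zero_left]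
  | succ m ih =>
    obtain ⟨l, rfl⟩ := exists_eq_add_single (Nat.ne_zero_of_lt h)
    obtain ⟨k, rfl⟩ := exists_eq_add_single (k := k) (i := i) (by omega)
    rw [hT.add_single, hT.add_single, hT.inner_apply_apply]
    simp only [Pi.add_apply, Pi.single_eq_same] at h hm
    exact ih (by omega) (by omega)

lemma inner_monomial [Fintype ι] (hT : IsDoublyCommutingShift T V) {w w' : K}
    (hw : w ∈ wanderingSubspace T) (hw' : w' ∈ wanderingSubspace T) {k l : ι → ℕ} (h : k ≠ l) :
    inner ℂ (V k w) (V l w') = 0 := by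
  obtain ⟨i, hi⟩ := Function.ne_iff.1 h
  rcases lt_or_gt_of_ne hi with hi | hi
  · exact hT.inner_monomial_of_lt hw hi
  · rw [← inner_conj_symm, hT.inner_monomial_of_lt hw' hi, map_zero]

/-- A nonzero subspace that reduces a pure isometry `T i` meets the kernel of `T i†`. -/
lemma exists_mem_ker (hT : IsDoublyCommutingShift T V) {N : Submodule ℂ K} {i : ι}
    (h₁ : ∀ x ∈ N, T i x ∈ N) (h₂ : ∀ x ∈ N, adjoint (T i) x ∈ N) (hN : N ≠ ⊥) :
    ∃ x ∈ N, adjoint (T i) x = 0 ∧ x ≠ 0 := by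
  obtain ⟨x, hx, hx0⟩ := N.ne_bot_iff.1 hN
  -- For `y` in `N`, the vector `y - T i (T i† y)` lies in `N` and in the kernel of `T i†`. If that
  -- intersection is trivial, `T i T i†` is the identity on `N`, so `x = T i ^ m (T i† ^ m x)` for
  -- every `m`, and purity forces `x = 0`.
  by_contra! hcon
  have hmem : ∀ m : ℕ, (adjoint (T i))^[m] x ∈ N := fun m => by
    induction m with
    | zero => exact hx
    | succ m ih => rw [Function.iterate_succ_apply']; exact h₂ _ ih
  refine hx0 (hT.pure i x fun m => ⟨(adjoint (T i))^[m] x, ?_⟩)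
  induction m with
  | zero => rfl
  | succ m ih =>
    set y := (adjoint (T i))^[m] x with hy
    have hz := hcon (y - T i (adjoint (T i) y))
      (N.sub_mem (hmem m) (h₁ _ (h₂ _ (hmem m)))) (by rw [map_sub, hT.isometry, sub_self])
    rw [Function.iterate_succ_apply, Function.iterate_succ_apply', ← hy, ← sub_eq_zero.1 hz]
    exact ih

/-- A nonzero subspace that reduces the operators `T i`, `i ∈ A`, meets their joint kernel. -/
lemma exists_mem_joint_ker (hT : IsDoublyCommutingShift T V) (A : Finset ι) {N : Submodule ℂ K}
    (h₁ : ∀ i ∈ A, ∀ x ∈ N, T i x ∈ N) (h₂ : ∀ i ∈ A, ∀ x ∈ N, adjoint (T i) x ∈ N)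
    (hN : N ≠ ⊥) : ∃ x ∈ N, (∀ i ∈ A, adjoint (T i) x = 0) ∧ x ≠ 0 := by
  induction A using Finset.induction_on generalizing N with
  | empty =>
    obtain ⟨x, hx, hx0⟩ := N.ne_bot_iff.1 hN
    exact ⟨x, hx, by simp, hx0⟩
  | insert i A hi ih =>
    obtain ⟨y, hy, hyi, hy0⟩ := hT.exists_mem_ker (h₁ i (A.mem_insert_self i))
      (h₂ i (A.mem_insert_self i)) hN
    have hker : ∀ x, x ∈ N ⊓ LinearMap.ker (adjoint (T i)).toLinearMap ↔
        x ∈ N ∧ adjoint (T i) x = 0 := fun x => by simp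
    -- The kernel of `T i†` reduces `T j` for `j ≠ i`: it is invariant under `T j` by double
    -- commutation and under `T j†` because the adjoints commute. Hence the induction hypothesis
    -- applies to its intersection with `N`.
    obtain ⟨x, hx, hxA, hx0⟩ := ih (N := N ⊓ LinearMap.ker (adjoint (T i)).toLinearMap)
      (fun j hj x hx => by
        rw [hker] at hx ⊢
        refine ⟨h₁ j (Finset.mem_insert_of_mem hj) x hx.1, ?_⟩
        rw [hT.doubly_comm i j (fun h => hi (h ▸ hj)), hx.2, map_zero])
      (fun j hj x hx => by
        rw [hker] at hx ⊢
        refine ⟨h₂ j (Finset.mem_insert_of_mem hj) x hx.1, ?_⟩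
        rw [hT.adjoint_comm, hx.2, map_zero])
      ((Submodule.ne_bot_iff _).2 ⟨y, (hker y).2 ⟨hy, hyi⟩, hy0⟩)
    rw [hker] at hx
    exact ⟨x, hx.1, Finset.forall_mem_insert _ _ _ |>.2 ⟨hx.2, hxA⟩, hx0⟩

/-- Wold decomposition: the monomials of the wandering subspace are total. -/
lemma eq_zero_of_inner_monomial [Fintype ι] (hT : IsDoublyCommutingShift T V) {x : K}
    (hx : ∀ k, ∀ w ∈ wanderingSubspace T, inner ℂ (V k w) x = 0) : x = 0 := by
  -- `N` is the orthogonal complement of all monomials of wandering vectors. It reduces every `T i`,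
  -- since `T i` raises an exponent and `T i†` lowers it or gives `0`. If nonzero, it would contain
  -- a nonzero wandering vector `y`, which is orthogonal to `V 0 y = y`.
  let N : Submodule ℂ K :=
    { carrier := {x | ∀ k, ∀ w ∈ wanderingSubspace T, inner ℂ (V k w) x = 0}
      add_mem' := fun {x y} hx hy k w hw => by rw [inner_add_right, hx k w hw, hy k w hw, add_zero]
      zero_mem' := fun k w _ => inner_zero_right _
      smul_mem' := fun c x hx k w hw => by rw [inner_smul_right, hx k w hw, mul_zero] }
  by_contra hx0
  obtain ⟨y, hyN, hy, hy0⟩ := hT.exists_mem_joint_ker Finset.univ (N := N)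
    (fun i _ y hy k w hw => by
      rw [← adjoint_inner_left]
      by_cases hk : k i = 0
      · rw [hT.adjoint_monomial_eq_zero hw k hk, inner_zero_left]
      · obtain ⟨l, rfl⟩ := exists_eq_add_single hk
        rw [hT.add_single, hT.isometry]
        exact hy l w hw)
    (fun i _ y hy k w hw => by
      rw [adjoint_inner_right, ← hT.add_single]
      exact hy _ w hw)
    ((Submodule.ne_bot_iff _).2 ⟨x, hx, hx0⟩)
  have h := hyN 0 y (mem_wanderingSubspace.2 fun i => hy i (Finset.mem_univ i))
  rw [hT.zero, inner_self_eq_zero] at h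
  exact hy0 h

end IsDoublyCommutingShift

end Wold

/-! ### Taylor coefficients, point evaluations and shifts on the Hardy space. -/

namespace Polydisc

open ContinuousLinearMap

variable {n : ℕ} {E : Type*} [NormedAddCommGroup E] [InnerProductSpace ℂ E] [CompleteSpace E]

lemma mon_add_single (k : Fin n → ℕ) (i : Fin n) (z : Fin n → ℂ) :
    mon (k + Pi.single i 1) z = z i * mon k z := by
  simp only [mon, Pi.add_apply, pow_add, Finset.prod_mul_distrib]
  rw [mul_comm, Finset.prod_eq_single i (fun j _ hj => by simp [hj]) (by simp)]
  simp

lemma mon_zero (z : Fin n → ℂ) : mon 0 z = 1 := by simp [mon]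

lemma norm_mon_le_one (k : Fin n → ℕ) {z : Fin n → ℂ} (hz : z ∈ polydisc n) : ‖mon k z‖ ≤ 1 := by
  simpa using norm_mon_le k z (r := 1) fun i => (hz i).le

lemma summable_norm_mon_sq {z : Fin n → ℂ} (hz : z ∈ polydisc n) :
    Summable fun k => ‖mon k z‖ ^ 2 := by
  obtain ⟨r, hr0, hr1, hr⟩ := exists_radius hz
  refine .of_nonneg_of_le (fun k => by positivity) (fun k => ?_) (summable_pow_sum hr0 hr1 n)
  calc ‖mon k z‖ ^ 2 ≤ ‖mon k z‖ := pow_le_of_le_one (norm_nonneg _) (norm_mon_le_one k hz) two_ne_zero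
    _ ≤ _ := norm_mon_le k z hr

namespace HardySpace

/-- The Taylor coefficient of index `k`. -/
def coeff (k : Fin n → ℕ) : HardySpace n E →L[ℂ] E :=
  lp.evalCLM ℂ (fun _ : Fin n → ℕ => E) 2 k ∘L
    ((coeffIso n E).symm.toContinuousLinearEquiv : HardySpace n E →L[ℂ] _)

lemma coeff_coeffIso (k : Fin n → ℕ) (a : lp (fun _ : Fin n → ℕ => E) 2) :
    coeff k (coeffIso n E a) = a k := by
  simp only [coeff, comp_apply, ContinuousLinearEquiv.coe_coe,
    LinearIsometryEquiv.coe_toContinuousLinearEquiv, LinearIsometryEquiv.symm_apply_apply]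
  rfl

lemma norm_coeff_le (k : Fin n → ℕ) : ‖(coeff k : HardySpace n E →L[ℂ] E)‖ ≤ 1 := by
  refine opNorm_le_bound _ zero_le_one fun f => ?_
  obtain ⟨a, rfl⟩ := (coeffIso n E).surjective f
  rw [coeff_coeffIso, LinearIsometryEquiv.norm_map, one_mul]
  exact lp.norm_apply_le_norm two_ne_zero a k

lemma hasSum_apply (f : HardySpace n E) {z : Fin n → ℂ} (hz : z ∈ polydisc n) :
    HasSum (fun k => mon k z • coeff k f) (f z) := by
  obtain ⟨a, rfl⟩ := (coeffIso n E).surjective f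
  simp only [coeff_coeffIso]
  exact hasSum_ofCoeff a hz

/-- The function `z ↦ zᵏ x`. -/
def monomial (k : Fin n → ℕ) : E →ₗᵢ[ℂ] HardySpace n E :=
  (coeffIso n E).toLinearIsometry.comp
    ⟨(lp.singleContinuousLinearMap ℂ (fun _ : Fin n → ℕ => E) 2 k).toLinearMap,
      lp.norm_single (E := fun _ : Fin n → ℕ => E) two_pos k⟩

lemma monomial_def (k : Fin n → ℕ) (x : E) :
    monomial k x = coeffIso n E (lp.single 2 k x) := rfl

lemma monomial_apply (k : Fin n → ℕ) (x : E) {z : Fin n → ℂ} (hz : z ∈ polydisc n) :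
    monomial k x z = mon k z • x := by
  refine (hasSum_apply _ hz).unique ?_
  convert hasSum_single k fun l hl => ?_ using 1
  · rw [monomial_def, coeff_coeffIso, lp.single_apply_self]
  · rw [monomial_def, coeff_coeffIso, lp.single_apply_ne _ _ _ hl, smul_zero]

lemma inner_monomial_left (k : Fin n → ℕ) (x : E) (f : HardySpace n E) :
    inner ℂ (monomial k x) f = inner ℂ x (coeff k f) := by
  obtain ⟨a, rfl⟩ := (coeffIso n E).surjective f
  rw [coeff_coeffIso, monomial_def, LinearIsometryEquiv.inner_map_map, lp.inner_single_left]

lemma inner_monomial_monomial (k l : Fin n → ℕ) (x y : E) :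
    inner ℂ (monomial k x) (monomial l y) = if k = l then inner ℂ x y else 0 := by
  rw [inner_monomial_left, monomial_def, coeff_coeffIso]
  split_ifs with h
  · rw [h, lp.single_apply_self]
  · rw [lp.single_apply_ne _ _ _ h, inner_zero_right]

lemma eq_zero_of_inner_monomial {f : HardySpace n E}
    (h : ∀ k x, inner ℂ (monomial k x) f = 0) : f = 0 := by
  obtain ⟨a, rfl⟩ := (coeffIso n E).surjective f
  have ha : a = 0 := by
    ext k
    have := h k (coeff k (coeffIso n E a))
    rw [inner_monomial_left, inner_self_eq_zero, coeff_coeffIso] at this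
    simpa using this
  rw [ha, map_zero]

lemma ext_inner_monomial {f g : HardySpace n E}
    (h : ∀ k x, inner ℂ (monomial k x) f = inner ℂ (monomial k x) g) : f = g :=
  sub_eq_zero.1 (eq_zero_of_inner_monomial fun k x => by rw [inner_sub_right, h, sub_self])

/-- The vectors `A† y` and `B† y` have the same inner products with the monomials, which are total.
Operator identities on the Hardy space are reduced to monomials in this way. -/
lemma ext_monomial {F : Type*} [NormedAddCommGroup F] [InnerProductSpace ℂ F]
    [CompleteSpace F] {A B : HardySpace n E →L[ℂ] F}
    (h : ∀ k x, A (monomial k x) = B (monomial k x)) (f : HardySpace n E) : A f = B f := by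
  refine ext_inner_left ℂ fun y => ?_
  rw [← adjoint_inner_left, ← adjoint_inner_left]
  congr 1
  refine ext_inner_monomial fun k x => ?_
  rw [adjoint_inner_right, adjoint_inner_right, h]

/-- The reproducing kernel estimate. -/
lemma norm_apply_sq_le (f : HardySpace n E) {z : Fin n → ℂ} (hz : z ∈ polydisc n) :
    ‖f z‖ ^ 2 ≤ (∑' k, ‖mon k z‖ ^ 2) * ‖f‖ ^ 2 := by
  obtain ⟨a, rfl⟩ := (coeffIso n E).surjective f
  rw [LinearIsometryEquiv.norm_map]
  have h1 : HasSum (fun k => mon k z • a k) (coeffIso n E a z) := hasSum_ofCoeff a hz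
  have h2 := lp.norm_rpow_eq_tsum (p := 2) (by norm_num) a
  simp only [ENNReal.toReal_ofNat, Real.rpow_ofNat] at h2
  have h3 : ∀ s : Finset (Fin n → ℕ), ‖∑ k ∈ s, mon k z • a k‖ ^ 2 ≤
      (∑' k, ‖mon k z‖ ^ 2) * ‖a‖ ^ 2 := fun s => by
    calc ‖∑ k ∈ s, mon k z • a k‖ ^ 2 ≤ (∑ k ∈ s, ‖mon k z‖ * ‖a k‖) ^ 2 := by
          gcongr
          exact norm_sum_le_of_le _ fun k _ => (norm_smul _ _).le
      _ ≤ (∑ k ∈ s, ‖mon k z‖ ^ 2) * ∑ k ∈ s, ‖a k‖ ^ 2 := Finset.sum_mul_sq_le_sq_mul_sq _ _ _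
      _ ≤ _ := by
          rw [h2]
          gcongr
          · exact (summable_norm_mon_sq hz).sum_le_tsum _ fun _ _ => by positivity
          · exact (sq_summable a).sum_le_tsum _ fun _ _ => by positivity
  exact le_of_tendsto' ((continuous_norm.pow 2).continuousAt.tendsto.comp h1) h3

/-- Evaluation at a point of the polydisc. -/
def evalAt (z : Fin n → ℂ) : HardySpace n E →L[ℂ] E := ∑' k, mon k z • coeff k

lemma summable_coeff {r : ℝ} (hr : 0 ≤ r) (hr1 : r < 1) :
    Summable fun k : Fin n → ℕ => ‖(coeff k : HardySpace n E →L[ℂ] E)‖ * r ^ (∑ i, k i) :=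
  summable_of_bound (s := 1) (M := 1) hr hr1 fun k => by simpa using norm_coeff_le k

lemma evalAt_apply {z : Fin n → ℂ} (hz : z ∈ polydisc n) (f : HardySpace n E) :
    evalAt z f = f z := by
  have hs : Summable fun k => mon k z • (coeff k : HardySpace n E →L[ℂ] E) := by
    obtain ⟨r, hr0, hr1, hr⟩ := exists_radius hz
    refine .of_norm_bounded (summable_coeff (E := E) hr0 hr1) fun k => ?_
    rw [norm_smul, mul_comm]
    exact mul_le_mul_of_nonneg_left (norm_mon_le k _ hr) (norm_nonneg _)
  have h := hs.hasSum.mapL (ContinuousLinearMap.apply ℂ E f)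
  exact h.unique (hasSum_apply f hz)

/-- `evalAt` is a power series whose coefficients are operators of norm at most `1`, so it is
analytic in operator norm and not only pointwise. The analyticity of `Θ` comes from here. -/
lemma analyticOnNhd_evalAt :
    AnalyticOnNhd ℂ (evalAt : (Fin n → ℂ) → HardySpace n E →L[ℂ] E) (polydisc n) :=
  series_analyticOnNhd fun _ hr hr1 => summable_coeff hr hr1

/-- The countably many copies `z^k E` of `E` have dense span. This makes the wandering subspace,
hence `E_*`, separable. -/
instance [TopologicalSpace.SeparableSpace E] : TopologicalSpace.SeparableSpace (HardySpace n E) := by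
  have h1 : TopologicalSpace.IsSeparable (⋃ k : Fin n → ℕ,
      Set.range (monomial k : E → HardySpace n E)) :=
    .iUnion fun k => TopologicalSpace.isSeparable_range (monomial k).continuous
  have h2 := (h1.span (R := ℂ)).closure
  rw [← Submodule.topologicalClosure_coe, Submodule.topologicalClosure_eq_top_iff.2,
    Submodule.top_coe, TopologicalSpace.isSeparable_univ_iff] at h2
  · exact h2
  · refine (Submodule.eq_bot_iff _).2 fun f hf => eq_zero_of_inner_monomial fun k x => ?_
    exact hf _ (Submodule.subset_span (Set.mem_iUnion.2 ⟨k, x, rfl⟩))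

end HardySpace

open HardySpace

lemma Mz_monomial (i : Fin n) (k : Fin n → ℕ) (x : E) :
    Mz i (monomial k x) = monomial (k + Pi.single i 1) x :=
  ext_polydisc fun z hz => by
    rw [Mz_apply, monomial_apply _ _ hz, monomial_apply _ _ hz, mon_add_single, smul_smul]

lemma adjoint_Mz_monomial_add (i : Fin n) (k : Fin n → ℕ) (x : E) :
    adjoint (Mz i) (monomial (k + Pi.single i 1) x) = monomial k x :=
  ext_inner_monomial fun l y => by
    rw [adjoint_inner_right, Mz_monomial, inner_monomial_monomial, inner_monomial_monomial]
    simp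

lemma adjoint_Mz_monomial_eq_zero (i : Fin n) {k : Fin n → ℕ} (hk : k i = 0) (x : E) :
    adjoint (Mz i) (monomial k x) = 0 :=
  ext_inner_monomial fun l y => by
    rw [adjoint_inner_right, Mz_monomial, inner_monomial_monomial, inner_zero_right, if_neg]
    rintro rfl
    simp at hk

lemma adjoint_Mz_Mz (i : Fin n) (f : HardySpace n E) : adjoint (Mz i) (Mz i f) = f :=
  ext_monomial (A := adjoint (Mz i) ∘L Mz i) (B := .id ℂ _) (fun k x => by
    simp only [comp_apply, Mz_monomial, adjoint_Mz_monomial_add, id_apply]) f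

lemma Mz_comm (i j : Fin n) (f : HardySpace n E) : Mz i (Mz j f) = Mz j (Mz i f) :=
  ext_polydisc fun z _ => by simp only [Mz_apply, smul_comm (z i)]

/-- On a monomial the two operators change different exponents. -/
lemma adjoint_Mz_comm {i j : Fin n} (hij : i ≠ j) (f : HardySpace n E) :
    adjoint (Mz i) (Mz j f) = Mz j (adjoint (Mz i) f) :=
  ext_monomial (A := adjoint (Mz i) ∘L Mz j) (B := Mz j ∘L adjoint (Mz i)) (fun k x => by
    simp only [comp_apply, Mz_monomial]
    by_cases hk : k i = 0
    · rw [adjoint_Mz_monomial_eq_zero i hk, map_zero,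
        adjoint_Mz_monomial_eq_zero i (by simp [hk, hij])]
    · obtain ⟨l, rfl⟩ : ∃ l, k = l + Pi.single i 1 := exists_eq_add_single hk
      rw [adjoint_Mz_monomial_add, Mz_monomial, add_right_comm, adjoint_Mz_monomial_add]) f

lemma inner_Mz_Mz (i : Fin n) (f g : HardySpace n E) :
    inner ℂ (Mz i f) (Mz i g) = inner ℂ f g := by
  rw [← adjoint_inner_left, adjoint_Mz_Mz]

lemma adjoint_Mz_iterate_monomial (i : Fin n) (k : Fin n → ℕ) (x : E) :
    (adjoint (Mz i))^[k i + 1] (monomial k x) = 0 := by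
  induction hm : k i generalizing k with
  | zero => exact adjoint_Mz_monomial_eq_zero i hm x
  | succ m ih =>
    obtain ⟨l, rfl⟩ : ∃ l, k = l + Pi.single i 1 := exists_eq_add_single (i := i) (by omega)
    rw [Function.iterate_succ_apply, adjoint_Mz_monomial_add]
    exact ih l (by simpa using hm)

lemma inner_iterate_Mz (i : Fin n) (m : ℕ) (f g : HardySpace n E) :
    inner ℂ f ((Mz i)^[m] g) = inner ℂ ((adjoint (Mz i))^[m] f) g := by
  induction m generalizing f with
  | zero => rfl
  | succ m ih => rw [Function.iterate_succ_apply', ← adjoint_inner_left, ih,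
      Function.iterate_succ_apply]

/-- Purity of the shift: `M_i†` applied `k i + 1` times kills `z^k x`, so `f` is orthogonal to every
monomial. -/
lemma eq_zero_of_forall_iterate_Mz (i : Fin n) {f : HardySpace n E}
    (h : ∀ m : ℕ, ∃ g, f = (Mz i)^[m] g) : f = 0 :=
  eq_zero_of_inner_monomial fun k x => by
    obtain ⟨g, rfl⟩ := h (k i + 1)
    rw [inner_iterate_Mz, adjoint_Mz_iterate_monomial, inner_zero_left]

lemma HInfty.mulOp_Mz {F : Type*} [NormedAddCommGroup F] [InnerProductSpace ℂ F] [CompleteSpace F]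
    (Θ : HInfty n E F) (i : Fin n) (f : HardySpace n E) :
    Θ.mulOp (Mz i f) = Mz i (Θ.mulOp f) :=
  ext_polydisc fun z _ => by simp

end Polydisc

namespace Polydisc

open ContinuousLinearMap HardySpace

/-! ### Shifts restricted to an invariant subspace. -/

section Restriction

variable {n : ℕ} {E : Type*} [NormedAddCommGroup E] [InnerProductSpace ℂ E] [CompleteSpace E]

/-- The bounded analytic function `z ↦ zᵏ I_E`. -/
def monomialHInfty (E : Type*) [NormedAddCommGroup E] [InnerProductSpace ℂ E] (k : Fin n → ℕ) :
    HInfty n E E where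
  toFun z := mon k z • ContinuousLinearMap.id ℂ E
  analytic z _ := by
    have h : AnalyticAt ℂ (mon k) z := Finset.analyticAt_fun_prod _ fun i _ =>
      ((ContinuousLinearMap.proj (R := ℂ) (φ := fun _ : Fin n => ℂ) i).analyticAt z).pow _
    exact h.smul analyticAt_const
  bounded := ⟨1, fun z hz => by
    rw [norm_smul]
    exact mul_le_one₀ (norm_mon_le_one k hz) (norm_nonneg _) ContinuousLinearMap.norm_id_le⟩

/-- The operator of multiplication by `zᵏ`. -/
def monMul (k : Fin n → ℕ) : HardySpace n E →L[ℂ] HardySpace n E := (monomialHInfty E k).mulOp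

lemma monMul_apply (k : Fin n → ℕ) (f : HardySpace n E) (z : Fin n → ℂ) :
    monMul k f z = mon k z • f z := rfl

lemma monMul_zero (f : HardySpace n E) : monMul 0 f = f :=
  ext_polydisc fun z _ => by rw [monMul_apply, mon_zero, one_smul]

lemma monMul_add_single (k : Fin n → ℕ) (i : Fin n) (f : HardySpace n E) :
    monMul (k + Pi.single i 1) f = Mz i (monMul k f) :=
  ext_polydisc fun z _ => by
    rw [monMul_apply, Mz_apply, monMul_apply, mon_add_single, smul_smul]

variable {S : Submodule ℂ (HardySpace n E)}

lemma monMul_mem (hS : ∀ i, ∀ f ∈ S, Mz i f ∈ S) (k : Fin n → ℕ) :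
    ∀ f ∈ S, monMul k f ∈ S := by
  intro f hf
  induction k using multiIndex_induction with
  | zero => rwa [monMul_zero]
  | add_single k i ih => rw [monMul_add_single]; exact hS i _ ih

/-- The restriction of an operator to an invariant subspace. -/
def restrictTo (A : HardySpace n E →L[ℂ] HardySpace n E) (hA : ∀ f ∈ S, A f ∈ S) : S →L[ℂ] S :=
  (A ∘L S.subtypeL).codRestrict S fun f => hA f f.2

@[simp] lemma coe_restrictTo (A : HardySpace n E →L[ℂ] HardySpace n E) (hA : ∀ f ∈ S, A f ∈ S)
    (f : S) : (restrictTo A hA f : HardySpace n E) = A f := rfl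

lemma adjoint_restrictTo_apply [CompleteSpace S] (A : HardySpace n E →L[ℂ] HardySpace n E)
    (hA : ∀ f ∈ S, A f ∈ S) (f : S) :
    adjoint (restrictTo A hA) f = S.orthogonalProjectionOnto (adjoint A f) := by
  refine ext_inner_right ℂ fun g => ?_
  rw [adjoint_inner_left, Submodule.inner_orthogonalProjectionOnto_eq_of_mem_right,
    adjoint_inner_left]
  rfl

lemma adjoint_restrictTo_restrictTo [CompleteSpace S] (hS : ∀ i, ∀ f ∈ S, Mz i f ∈ S) (i : Fin n)
    (f : S) : adjoint (restrictTo (Mz i) (hS i)) (restrictTo (Mz i) (hS i) f) = f :=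
  ext_inner_right ℂ fun g => by
    rw [adjoint_inner_left, Submodule.coe_inner, coe_restrictTo, coe_restrictTo, inner_Mz_Mz]
    rfl

/-- Isometry, commutation and purity are inherited from the shifts on the Hardy space. Double
commutation is not, because the adjoint of a restriction involves the projection onto `S`. -/
lemma isDoublyCommutingShift_restrictTo [CompleteSpace S] (hS : ∀ i, ∀ f ∈ S, Mz i f ∈ S)
    (hdc : ∀ i j, i ≠ j → ∀ f : S, adjoint (restrictTo (Mz i) (hS i)) (restrictTo (Mz j) (hS j) f) =
      restrictTo (Mz j) (hS j) (adjoint (restrictTo (Mz i) (hS i)) f)) :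
    IsDoublyCommutingShift (fun i => restrictTo (Mz i) (hS i))
      fun k => restrictTo (monMul k) (monMul_mem hS k) where
  zero f := Subtype.ext (monMul_zero _)
  add_single k i f := Subtype.ext (monMul_add_single k i _)
  isometry i f := adjoint_restrictTo_restrictTo hS i f
  comm i j f := Subtype.ext (Mz_comm i j _)
  doubly_comm := hdc
  pure i f hf := Subtype.ext <| eq_zero_of_forall_iterate_Mz i fun m => by
    obtain ⟨g, rfl⟩ := hf m
    exact ⟨g, Function.Semiconj.iterate_right (f := Subtype.val) (fun _ => rfl) m g⟩

end Restriction

/-! ### Inner functions from wandering subspaces. -/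

section InnerFunction

variable {n : ℕ} {E W : Type*} [NormedAddCommGroup E] [InnerProductSpace ℂ E] [CompleteSpace E]
  [NormedAddCommGroup W] [InnerProductSpace ℂ W] [CompleteSpace W]
  {J : W →ₗᵢ[ℂ] HardySpace n E}

/-- The `z^k J(W)` are pairwise orthogonal isometric copies of `W`, so the Hilbert sum of copies of
`W`, which is `H²_W` in coefficients, embeds isometrically. -/
lemma exists_isometry_of_orthogonal (hnorm : ∀ k w, ‖monMul k (J w)‖ = ‖w‖)
    (horth : ∀ k l, k ≠ l → ∀ w w', inner ℂ (monMul k (J w)) (monMul l (J w')) = 0) :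
    ∃ U : HardySpace n W →ₗᵢ[ℂ] HardySpace n E, ∀ k w, U (monomial k w) = monMul k (J w) := by
  let V : (Fin n → ℕ) → W →ₗᵢ[ℂ] HardySpace n E := fun k =>
    ⟨(monMul k).toLinearMap ∘ₗ J.toLinearMap, hnorm k⟩
  have hV : OrthogonalFamily ℂ (fun _ : Fin n → ℕ => W) V := fun k l hkl w w' => horth k l hkl w w'
  refine ⟨hV.linearIsometry.comp (coeffIso n W).symm.toLinearIsometry, fun k w => ?_⟩
  change hV.linearIsometry ((coeffIso n W).symm (coeffIso n W (lp.single 2 k w))) = _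
  rw [LinearIsometryEquiv.symm_apply_apply, hV.linearIsometry_apply_single]
  rfl

/-- An isometry from `H²_W` that sends `zᵏ w` to `zᵏ (J w)` acts as pointwise multiplication. -/
lemma apply_eq_of_monomial {U : HardySpace n W →ₗᵢ[ℂ] HardySpace n E}
    (hU : ∀ k w, U (monomial k w) = monMul k (J w)) (f : HardySpace n W) {z : Fin n → ℂ}
    (hz : z ∈ polydisc n) : U f z = J (f z) z := by
  -- Both sides are bounded operators in `f`. On the right, `J` is applied to the constant vector `f
  -- z` and the resulting function is evaluated at `z`; at `z^k w` both sides equal `z^k (J w)(z)`.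
  have h := ext_monomial (A := evalAt z ∘L U.toContinuousLinearMap)
    (B := evalAt z ∘L J.toContinuousLinearMap ∘L evalAt z) (fun k w => by
      simp only [comp_apply, LinearIsometry.coe_toContinuousLinearMap, evalAt_apply hz, hU,
        monMul_apply, monomial_apply _ _ hz, map_smul, HardySpace.smul_apply]) f
  simpa only [comp_apply, LinearIsometry.coe_toContinuousLinearMap, evalAt_apply hz] using h

/-- Values of the image of an isometric multiplier are dominated: test on `ζ ↦ ∑ₖ ζᵏ z̄ᵏ w`. -/
lemma norm_apply_le_of_monomial {U : HardySpace n W →ₗᵢ[ℂ] HardySpace n E}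
    (hU : ∀ k w, U (monomial k w) = monMul k (J w)) (w : W) {z : Fin n → ℂ}
    (hz : z ∈ polydisc n) : ‖J w z‖ ≤ ‖w‖ := by
  set c := ∑' k, ‖mon k z‖ ^ 2 with hc
  have hsum := summable_norm_mon_sq hz
  have hc0 : 0 < c := hsum.tsum_pos (fun k => by positivity) 0 (by simp [mon_zero])
  have hsq : ∀ k, ‖conj (mon k z) • w‖ ^ 2 = ‖mon k z‖ ^ 2 * ‖w‖ ^ 2 := fun k => by
    rw [norm_smul, RCLike.norm_conj, mul_pow]
  let a : lp (fun _ : Fin n → ℕ => W) 2 := ⟨fun k => conj (mon k z) • w, memℓp_gen (by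
    simpa only [ENNReal.toReal_ofNat, Real.rpow_ofNat, hsq] using hsum.mul_right _)⟩
  have ha : ‖coeffIso n W a‖ ^ 2 = c * ‖w‖ ^ 2 := by
    have h := lp.norm_rpow_eq_tsum (p := 2) (by norm_num) a
    simp only [ENNReal.toReal_ofNat, Real.rpow_ofNat] at h
    rw [LinearIsometryEquiv.norm_map, h, hc, ← tsum_mul_right]
    exact tsum_congr hsq
  have hz1 : coeffIso n W a z = (c : ℂ) • w := by
    have h : HasSum (fun k => mon k z • conj (mon k z) • w) (coeffIso n W a z) := hasSum_ofCoeff a hz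
    refine h.unique ?_
    have h2 := (Complex.hasSum_ofReal.2 hsum.hasSum).smul_const w
    refine h2.congr_fun fun k => ?_
    rw [smul_smul, Complex.mul_conj, Complex.normSq_eq_norm_sq]
  -- The test function has squared norm `c ‖w‖²` and value `c w` at `z`. The kernel estimate for its
  -- image therefore reads `c² ‖J w z‖² ≤ c · c ‖w‖²`.
  have h := norm_apply_sq_le (U (coeffIso n W a)) hz
  rw [apply_eq_of_monomial hU _ hz, hz1, map_smul, HardySpace.smul_apply, norm_smul, LinearIsometry.norm_map,
    ha, ← hc, Complex.norm_real, Real.norm_of_nonneg hc0.le] at h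
  refine le_of_sq_le_sq ?_ (norm_nonneg _)
  have hc2 : 0 < c ^ 2 := by positivity
  exact le_of_mul_le_mul_left (by nlinarith) hc2

/-- The analytic function `z ↦ (w ↦ (J w) z)`. -/
def evalHInfty {U : HardySpace n W →ₗᵢ[ℂ] HardySpace n E}
    (hU : ∀ k w, U (monomial k w) = monMul k (J w)) : HInfty n W E where
  toFun z := evalAt z ∘L J.toContinuousLinearMap
  analytic z hz :=
    ((compL ℂ W (HardySpace n E) E).flip J.toContinuousLinearMap).analyticAt _ |>.comp
      (analyticOnNhd_evalAt z hz)
  bounded := ⟨1, fun z hz => opNorm_le_bound _ zero_le_one fun w => by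
    rw [one_mul, comp_apply, evalAt_apply hz]
    exact norm_apply_le_of_monomial hU w hz⟩

lemma mulOp_evalHInfty {U : HardySpace n W →ₗᵢ[ℂ] HardySpace n E}
    (hU : ∀ k w, U (monomial k w) = monMul k (J w)) (f : HardySpace n W) :
    (evalHInfty hU).mulOp f = U f :=
  ext_polydisc fun z hz => by
    rw [HInfty.mulOp_apply, apply_eq_of_monomial hU f hz]
    exact evalAt_apply hz _

/-- The isometry with these values on monomials is multiplication by `Θ(z) w = (J w)(z)`, and the
kernel estimate bounds `‖Θ(z)‖` by `1`. -/
lemma exists_inner_of_orthogonal (hnorm : ∀ k w, ‖monMul k (J w)‖ = ‖w‖)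
    (horth : ∀ k l, k ≠ l → ∀ w w', inner ℂ (monMul k (J w)) (monMul l (J w')) = 0) :
    ∃ Θ : HInfty n W E, Θ.IsInner ∧ ∀ k w, Θ.mulOp (monomial k w) = monMul k (J w) := by
  obtain ⟨U, hU⟩ := exists_isometry_of_orthogonal hnorm horth
  refine ⟨evalHInfty hU, ?_, fun k w => by rw [mulOp_evalHInfty, hU]⟩
  have : ⇑(evalHInfty hU).mulOp = U := funext (mulOp_evalHInfty hU)
  rw [HInfty.IsInner, this]
  exact U.isometry

/-- The projection onto `Sᗮ` composed with `A` vanishes on monomials, hence everywhere; completeness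
of `S` gives `Sᗮᗮ = S`. -/
lemma apply_mem_of_monomial {S : Submodule ℂ (HardySpace n E)} [CompleteSpace S]
    {A : HardySpace n W →L[ℂ] HardySpace n E} (hA : ∀ k w, A (monomial k w) ∈ S)
    (f : HardySpace n W) : A f ∈ S := by
  have h := ext_monomial (A := Sᗮ.orthogonalProjectionOnto ∘L A) (B := 0) (fun k w => by
    rw [comp_apply, _root_.zero_apply, Submodule.orthogonalProjectionOnto_eq_zero_iff]
    exact S.le_orthogonal_orthogonal (hA k w)) f
  rwa [comp_apply, _root_.zero_apply, Submodule.orthogonalProjectionOnto_eq_zero_iff,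
    Submodule.orthogonal_orthogonal] at h

end InnerFunction

/-! ### Double commutation, inner functions and the defect operators of `Q`. -/

section Beurling

variable {n : ℕ} {E : Type u} [NormedAddCommGroup E] [InnerProductSpace ℂ E] [CompleteSpace E]

lemma norm_monMul (k : Fin n → ℕ) (f : HardySpace n E) : ‖monMul k f‖ = ‖f‖ := by
  induction k using multiIndex_induction with
  | zero => rw [monMul_zero]
  | add_single k i ih =>
    rw [monMul_add_single, norm_eq_sqrt_re_inner (𝕜 := ℂ), inner_Mz_Mz, ← norm_eq_sqrt_re_inner, ih]

/-- Wold decomposition of an invariant subspace on which the coordinate multipliers doubly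
commute. -/
lemma exists_wandering {S : Submodule ℂ (HardySpace n E)} [CompleteSpace S]
    (hS : ∀ i, ∀ f ∈ S, Mz i f ∈ S)
    (hdc : ∀ i j, i ≠ j → ∀ f : S, adjoint (restrictTo (Mz i) (hS i)) (restrictTo (Mz j) (hS j) f) =
      restrictTo (Mz j) (hS j) (adjoint (restrictTo (Mz i) (hS i)) f)) :
    ∃ W : Submodule ℂ (HardySpace n E), IsClosed (W : Set (HardySpace n E)) ∧ W ≤ S ∧
      (∀ k l, k ≠ l → ∀ w ∈ W, ∀ w' ∈ W, inner ℂ (monMul k w) (monMul l w') = 0) ∧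
      ∀ s ∈ S, (∀ k, ∀ w ∈ W, inner ℂ (monMul k w) s = 0) → s = 0 := by
  have hT := isDoublyCommutingShift_restrictTo hS hdc
  have hSc : IsClosed (S : Set (HardySpace n E)) :=
    (completeSpace_coe_iff_isComplete.1 ‹CompleteSpace S›).isClosed
  refine ⟨(wanderingSubspace fun i => restrictTo (Mz i) (hS i)).map S.subtype, ?_,
    Submodule.map_subtype_le _ _, ?_, fun s hs h => ?_⟩
  · have h := isClosed_wanderingSubspace (T := fun i => restrictTo (Mz i) (hS i))
    exact hSc.isClosedEmbedding_subtypeVal.isClosedMap _ h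
  · rintro k l hkl _ ⟨w, hw, rfl⟩ _ ⟨w', hw', rfl⟩
    exact hT.inner_monomial hw hw' hkl
  · exact congrArg Subtype.val (hT.eq_zero_of_inner_monomial (x := ⟨s, hs⟩) fun k w hw =>
      h k w ⟨w, hw, rfl⟩)

/-- An invariant subspace on which the coordinate multipliers doubly commute is the range of an
inner function. -/
lemma exists_inner_of_doubly_comm [TopologicalSpace.SeparableSpace E]
    {S : Submodule ℂ (HardySpace n E)} [CompleteSpace S] (hS : ∀ i, ∀ f ∈ S, Mz i f ∈ S)
    (hdc : ∀ i j, i ≠ j → ∀ f : S, adjoint (restrictTo (Mz i) (hS i)) (restrictTo (Mz j) (hS j) f) =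
      restrictTo (Mz j) (hS j) (adjoint (restrictTo (Mz i) (hS i)) f)) :
    ∃ (W : Type u) (_ : NormedAddCommGroup W) (_ : InnerProductSpace ℂ W) (_ : CompleteSpace W)
      (_ : TopologicalSpace.SeparableSpace W) (Θ : HInfty n W E), Θ.IsInner ∧
      (∀ f, Θ.mulOp f ∈ S) ∧ ∀ s ∈ S, (∀ f, inner ℂ (Θ.mulOp f) s = 0) → s = 0 := by
  obtain ⟨W, hWc, hWS, horth, htot⟩ := exists_wandering hS hdc
  have : CompleteSpace W := hWc.completeSpace_coe
  -- `E_*` is `W` itself; second countability, unlike separability, passes to every subspace.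
  have : SecondCountableTopology (HardySpace n E) := UniformSpace.secondCountable_of_separable _
  obtain ⟨Θ, hΘ, hΘW⟩ := exists_inner_of_orthogonal (J := W.subtypeₗᵢ)
    (fun k w => norm_monMul k (w : HardySpace n E))
    fun k l hkl w w' => horth k l hkl w w.2 w' w'.2
  refine ⟨W, inferInstance, inferInstance, inferInstance, inferInstance, Θ, hΘ,
    apply_mem_of_monomial fun k w => ?_, fun s hs h => htot s hs fun k w hw => ?_⟩
  · rw [hΘW]
    exact monMul_mem hS k _ (hWS w.2)
  · have := h (monomial k ⟨w, hw⟩)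
    rwa [hΘW] at this

/-- The coordinate multipliers doubly commute on the range of an inner function. -/
lemma doubly_comm_of_inner {W : Type*} [NormedAddCommGroup W] [InnerProductSpace ℂ W]
    [CompleteSpace W] {Θ : HInfty n W E} (hΘ : Θ.IsInner)
    {S : Submodule ℂ (HardySpace n E)} [CompleteSpace S] (hS : ∀ i, ∀ f ∈ S, Mz i f ∈ S)
    (hSΘ : S = LinearMap.range Θ.mulOp.toLinearMap) {i j : Fin n} (hij : i ≠ j) (s : S) :
    adjoint (restrictTo (Mz i) (hS i)) (restrictTo (Mz j) (hS j) s) =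
      restrictTo (Mz j) (hS j) (adjoint (restrictTo (Mz i) (hS i)) s) := by
  have hmem : ∀ f, Θ.mulOp f ∈ S := fun f => hSΘ ▸ LinearMap.mem_range_self _ f
  have hrange : ∀ s : S, ∃ f, s = ⟨Θ.mulOp f, hmem f⟩ := by
    rintro ⟨s, hs⟩
    obtain ⟨f, rfl⟩ := LinearMap.mem_range.1 (hSΘ ▸ hs)
    exact ⟨f, rfl⟩
  have hinner : ∀ f g, inner ℂ (Θ.mulOp f) (Θ.mulOp g) = inner ℂ f g :=
    (LinearIsometry.mk Θ.mulOp.toLinearMap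
      ((AddMonoidHomClass.isometry_iff_norm Θ.mulOp).1 hΘ)).inner_map_map
  -- `M_Θ` is unitary onto `S` and intertwines the shifts with their restrictions, so it also
  -- intertwines the adjoints.
  have hadj : ∀ i f, adjoint (restrictTo (Mz i) (hS i)) ⟨Θ.mulOp f, hmem f⟩ =
      ⟨Θ.mulOp (adjoint (Mz i) f), hmem _⟩ := fun i f => ext_inner_right ℂ fun g => by
    obtain ⟨g, rfl⟩ := hrange g
    rw [adjoint_inner_left, Submodule.coe_inner, Submodule.coe_inner, coe_restrictTo]
    dsimp only
    rw [← HInfty.mulOp_Mz, hinner, hinner, adjoint_inner_left]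
  have hmul : ∀ i f, restrictTo (Mz i) (hS i) ⟨Θ.mulOp f, hmem f⟩ = ⟨Θ.mulOp (Mz i f), hmem _⟩ :=
    fun i f => Subtype.ext (Θ.mulOp_Mz i f).symm
  obtain ⟨f, rfl⟩ := hrange s
  rw [hmul, hadj, hadj, hmul, adjoint_Mz_comm hij]

variable (Q : ClosedSubmodule ℂ (HardySpace n E))

/-- The operator `P_{Q^⊥} M_{zᵢ}|_Q`. -/
def corner (i : Fin n) : Q.toSubmodule →L[ℂ] (Q.toSubmoduleᗮ : Submodule ℂ (HardySpace n E)) :=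
  Q.toSubmoduleᗮ.orthogonalProjectionOnto ∘L Mz i ∘L Q.toSubmodule.subtypeL

lemma inner_eq_add (f g : HardySpace n E) : inner ℂ f g =
    inner ℂ (Q.toSubmodule.orthogonalProjectionOnto f) (Q.toSubmodule.orthogonalProjectionOnto g) +
    inner ℂ (Q.toSubmoduleᗮ.orthogonalProjectionOnto f)
      (Q.toSubmoduleᗮ.orthogonalProjectionOnto g) := by
  rw [Submodule.inner_orthogonalProjectionOnto_eq_of_mem_left,
    Submodule.inner_orthogonalProjectionOnto_eq_of_mem_left, ← inner_add_left]
  congr 1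
  exact (Submodule.starProjection_add_starProjection_orthogonal f).symm

lemma adjoint_corner_apply (i : Fin n) (s : (Q.toSubmoduleᗮ : Submodule ℂ (HardySpace n E))) :
    adjoint (corner Q i) s = Q.toSubmodule.orthogonalProjectionOnto (adjoint (Mz i) s) := by
  rw [corner, adjoint_comp, adjoint_comp, Submodule.adjoint_orthogonalProjectionOnto,
    Submodule.adjoint_subtypeL]
  rfl

/-- `⟨f, g⟩ = ⟨M_i f, M_i g⟩` because `M_i` is isometric; the right side splits into its `Q` part,
given by `C_i`, and its `Qᗮ` part, given by `B_i`. -/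
lemma one_sub_compression (i : Fin n) :
    1 - adjoint (compression Q i) * compression Q i = adjoint (corner Q i) ∘L corner Q i := by
  ext1 f
  refine ext_inner_right ℂ fun g => ?_
  have h := inner_eq_add Q (Mz i f) (Mz i g)
  rw [inner_Mz_Mz] at h
  rw [sub_apply, one_apply_eq_self, mul_apply_eq_comp, inner_sub_left, adjoint_inner_left, comp_apply,
    adjoint_inner_left, sub_eq_iff_eq_add']
  exact h

/-- As `A† A x = 0` forces `A x = 0`, the outer factor of `B_i† B_i B_j† B_j = 0` can be dropped.
After passing to adjoints the same works on the other side, leaving `B_j B_i† = 0`. -/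
lemma mul_eq_zero_iff (i j : Fin n) :
    (1 - adjoint (compression Q i) * compression Q i) *
      (1 - adjoint (compression Q j) * compression Q j) = 0 ↔
      ∀ s t, inner ℂ (adjoint (corner Q j) s) (adjoint (corner Q i) t) = 0 := by
  have key : ∀ {X Y : Type u} [NormedAddCommGroup X] [InnerProductSpace ℂ X] [CompleteSpace X]
      [NormedAddCommGroup Y] [InnerProductSpace ℂ Y] [CompleteSpace Y] (A : X →L[ℂ] Y) (x : X),
      adjoint A (A x) = 0 → A x = 0 := fun A x h => by
    rw [← inner_self_eq_zero (𝕜 := ℂ), ← adjoint_inner_left, h, inner_zero_left]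
  rw [one_sub_compression, one_sub_compression]
  constructor
  · intro h s t
    have h1 : ∀ x, corner Q i (adjoint (corner Q j) (corner Q j x)) = 0 := fun x =>
      key _ _ (DFunLike.congr_fun h x)
    have h2 : ∀ t, corner Q j (adjoint (corner Q i) t) = 0 := fun t => by
      refine key _ _ (ext_inner_right ℂ fun x => ?_)
      rw [adjoint_inner_left, ← adjoint_inner_right, adjoint_inner_left, h1, inner_zero_right,
        inner_zero_left]
    rw [adjoint_inner_left, h2, inner_zero_right]
  · intro h
    ext1 x
    refine ext_inner_right ℂ fun y => ?_
    change inner ℂ (adjoint (corner Q i) (corner Q i (adjoint (corner Q j) (corner Q j x)))) y = _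
    rw [adjoint_inner_left, ← adjoint_inner_right, h, _root_.zero_apply, inner_zero_left]

lemma mul_eq_zero_iff_doubly_comm (hS : ∀ i, ∀ f ∈ Q.toSubmoduleᗮ, Mz i f ∈ Q.toSubmoduleᗮ)
    {i j : Fin n} (hij : i ≠ j) :
    (1 - adjoint (compression Q i) * compression Q i) *
      (1 - adjoint (compression Q j) * compression Q j) = 0 ↔
      ∀ f, adjoint (restrictTo (Mz j) (hS j)) (restrictTo (Mz i) (hS i) f) =
        restrictTo (Mz i) (hS i) (adjoint (restrictTo (Mz j) (hS j)) f) := by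
  -- The left side is `⟨M_j† M_i s, t⟩ = ⟨M_i M_j† s, t⟩ = ⟨M_j† s, M_i† t⟩`, by double commutation
  -- on the full Hardy space. The projections of `M_j† s` and `M_i† t` to `Q` and `Qᗮ` are the
  -- adjoints of the corners and of the restrictions.
  have key : ∀ s t : (Q.toSubmoduleᗮ : Submodule ℂ (HardySpace n E)),
      inner ℂ (adjoint (restrictTo (Mz j) (hS j)) (restrictTo (Mz i) (hS i) s)) t =
      inner ℂ (adjoint (corner Q j) s) (adjoint (corner Q i) t) +
      inner ℂ (restrictTo (Mz i) (hS i) (adjoint (restrictTo (Mz j) (hS j)) s)) t := fun s t => by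
    rw [← adjoint_inner_right (restrictTo (Mz i) (hS i)), adjoint_corner_apply,
      adjoint_corner_apply, adjoint_restrictTo_apply (Mz j) (hS j) s,
      adjoint_restrictTo_apply (Mz i) (hS i) t, ← inner_eq_add,
      adjoint_inner_left (restrictTo (Mz j) (hS j)), adjoint_inner_right, ← adjoint_Mz_comm hij.symm, adjoint_inner_left]
    rfl
  rw [mul_eq_zero_iff]
  constructor
  · intro h s
    exact ext_inner_right ℂ fun t => by rw [key, h, zero_add]
  · intro h s t
    have := key s t
    rwa [h, right_eq_add] at this

lemma Mz_mem_orthogonal {Q : ClosedSubmodule ℂ (HardySpace n E)} (hQ : IsQuotientModule Q)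
    (i : Fin n) : ∀ f ∈ Q.toSubmoduleᗮ, Mz i f ∈ Q.toSubmoduleᗮ := fun f hf q hq => by
  rw [← adjoint_inner_left]
  exact hf _ (hQ i q hq)

end Beurling

end Polydisc

end

theorem theorem1p1 {n : ℕ} (hn : 1 ≤ n) {E : Type u} [NormedAddCommGroup E]
    [InnerProductSpace ℂ E] [CompleteSpace E] [TopologicalSpace.SeparableSpace E]
    (Q : ClosedSubmodule ℂ (Polydisc.HardySpace n E)) (hQ : Polydisc.IsQuotientModule Q) :
    Polydisc.IsBeurlingQuotientModule Q ↔
      ∀ i j : Fin n, i ≠ j →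
        (1 - ContinuousLinearMap.adjoint (Polydisc.compression Q i) * Polydisc.compression Q i) *
          (1 - ContinuousLinearMap.adjoint (Polydisc.compression Q j) *
            Polydisc.compression Q j) = 0 := by
  have hS := Polydisc.Mz_mem_orthogonal hQ
  have horth : Q.toSubmoduleᗮᗮ = Q.toSubmodule := Submodule.orthogonal_orthogonal _
  constructor
  · rintro ⟨W, _, _, _, _, Θ, hΘ, hQΘ⟩ i j hij
    -- An isometry of a complete space has closed range, so `Qᗮ` is the range itself and not only
    -- its closure.
    have hcl : IsClosed (LinearMap.range Θ.mulOp.toLinearMap : Set (Polydisc.HardySpace n E)) := by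
      rw [LinearMap.coe_range]
      exact hΘ.isClosedEmbedding.isClosed_range
    have hSΘ : Q.toSubmoduleᗮ = LinearMap.range Θ.mulOp.toLinearMap := by
      have := hcl.completeSpace_coe
      rw [hQΘ, Submodule.orthogonal_orthogonal]
    exact (Polydisc.mul_eq_zero_iff_doubly_comm Q hS hij).2
      (Polydisc.doubly_comm_of_inner hΘ hS hSΘ hij.symm)
  · intro h
    -- The indices are swapped: the product with factors `j`, `i` in this order encodes that `R_i†`
    -- commutes with `R_j`.
    obtain ⟨W, i₁, i₂, i₃, i₄, Θ, hΘ, hmem, htot⟩ := Polydisc.exists_inner_of_doubly_comm hS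
      fun i j hij => (Polydisc.mul_eq_zero_iff_doubly_comm Q hS hij.symm).1 (h j i hij.symm)
    refine ⟨W, i₁, i₂, i₃, i₄, Θ, hΘ, le_antisymm (fun q hq => ?_) fun x hx => ?_⟩
    · rintro _ ⟨f, rfl⟩
      exact Submodule.inner_left_of_mem_orthogonal hq (hmem f)
    -- `x` is orthogonal to the range of `M_Θ`, and so is its `Q` part `x - s`, because the range
    -- lies in `Qᗮ`. Hence `s` is orthogonal to the range too, and totality gives `s = 0`.
    · set s := Q.toSubmoduleᗮ.orthogonalProjectionOnto x with hs
      have hxs : x - s ∈ Q.toSubmodule :=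
        horth.le (Submodule.sub_starProjection_mem_orthogonal x)
      have hs0 : (s : Polydisc.HardySpace n E) = 0 := htot s s.2 fun f => by
        have h1 : inner ℂ (Θ.mulOp f) x = 0 :=
          hx _ (LinearMap.mem_range_self Θ.mulOp.toLinearMap f)
        have h2 := Submodule.inner_right_of_mem_orthogonal hxs (hmem f)
        rwa [← inner_conj_symm, map_eq_zero, inner_sub_right, h1, zero_sub, neg_eq_zero] at h2
      rwa [hs0, sub_zero] at hxs
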